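/- Write $e(t)=e^{2\pi i t}$ and $\|f\|_1=\int_0^1|f(t)|\,dt$. Let $C_{MPS}$ be the largest real constant $C$ such that $$\int_0^1\Bigl|\sum_{j=1}^n u_j e(a_jt)\Bigr|\,dt\ \ge\ C\sum_{j=1}^n\frac{|u_j|}{j}$$ for every $n$, all integers $a_1<\dots<a_n$ and all complex numbers $u_1,\dots,u_n$ (the constant in the McGehee–Pigno–Smith inequality). Then $C_{MPS}>0$, and the following holds. Let $d_1,d_2$ be positive integers and $\delta>0$ a real number with $(2+\delta)d_1<d_2$. Let $I$ be a finite set of integers and let $$F(t)=\sum_{k\in I}f_k(t)\,e(d_2kt),\qquad f_k(t)=\sum_{|n|\le d_1}a_{n,k}\,e(nt),$$ with complex coefficients $a_{n,k}$. Let $q$ and $s$ be integers with $q>4\pi$, and let $k_1<\dots<k_J$ be the elements of $I(q;s)=\{k\in I: k\equiv s \bmod q\}$. Then $$\|F\|_1\ \ge\ \frac{1}{32\pi\,(2+\log(1+2/\delta))}\sum_{j=1}^J\|f_{k_j}\|_1\left(\frac{C_{MPS}}{2j}-\frac{2\pi d_1}{q\,d_2}\right).$$ -/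

import Mathlib

namespace TrigSum

noncomputable section

/-- The additive character `e(t) = exp(2 π i t)`. -/
def e (t : ℝ) : ℂ := Complex.exp (2 * (Real.pi : ℂ) * Complex.I * (t : ℂ))

/-- The norm of `L¹([0,1])`. In this development it is only applied to continuous functions
(finite exponential sums), for which the integrand is integrable. -/
def normL1 (f : ℝ → ℂ) : ℝ := ∫ t in (0 : ℝ)..1, ‖f t‖

/-- The trigonometric polynomial `t ↦ ∑_{|n| ≤ d} c_n e(n t)` of degree at most `d`. -/
def trigPoly (d : ℕ) (c : ℤ → ℂ) (t : ℝ) : ℂ :=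
  ∑ n ∈ Finset.Icc (-(d : ℤ)) (d : ℤ), c n * e ((n : ℝ) * t)

/-- `I(q; s)`, the elements of `I` congruent to `s` modulo `q`. -/
def residueClass (I : Finset ℤ) (q s : ℤ) : Finset ℤ :=
  {k ∈ I | k ≡ s [ZMOD q]}

/-- `C` is admissible in the McGehee–Pigno–Smith inequality: for all integers
`a_1 < ... < a_n` and all complex `u_1, ..., u_n`,
`C * ∑_j |u_j| / j ≤ ∫_0^1 |∑_j u_j e(a_j t)| dt`.
The index `j : Fin n` is zero-based, so it stands for the index `j + 1` of the formula. -/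
def IsMPSConstant (C : ℝ) : Prop :=
  ∀ (n : ℕ) (a : Fin n → ℤ) (u : Fin n → ℂ), StrictMono a →
    C * ∑ j : Fin n, ‖u j‖ / ((j : ℝ) + 1) ≤
      normL1 (fun t => ∑ j : Fin n, u j * e ((a j : ℝ) * t))

/-- The McGehee–Pigno–Smith constant: the largest admissible constant
(see `isGreatest_mpsConstant`). -/
def mpsConstant : ℝ := sSup {C : ℝ | IsMPSConstant C}

theorem IsMPSConstant.le_one {C : ℝ} (h : IsMPSConstant C) : C ≤ 1 := by
  have := h 1 (fun _ => 0) (fun _ => 1) (Subsingleton.strictMono _)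
  simpa [normL1, e] using this

theorem normL1_nonneg (f : ℝ → ℂ) : 0 ≤ normL1 f :=
  intervalIntegral.integral_nonneg zero_le_one fun _ _ => norm_nonneg _

/-- The supremum defining `mpsConstant` is a maximum: `mpsConstant` is itself admissible. -/
theorem isGreatest_mpsConstant : IsGreatest {C : ℝ | IsMPSConstant C} mpsConstant := by
  have h0 : (0 : ℝ) ∈ {C : ℝ | IsMPSConstant C} := by
    intro n a u _
    rw [zero_mul]
    exact normL1_nonneg _
  have hb : BddAbove {C : ℝ | IsMPSConstant C} := ⟨1, fun _ h => h.le_one⟩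
  refine ⟨?_, fun C hC => le_csSup hb hC⟩
  intro n a u ha
  have hT : 0 ≤ ∑ j : Fin n, ‖u j‖ / ((j : ℝ) + 1) :=
    Finset.sum_nonneg fun j _ => by positivity
  rcases hT.eq_or_lt with h | h
  · rw [← h, mul_zero]
    exact normL1_nonneg _
  · rw [← le_div_iff₀ h]
    exact csSup_le ⟨0, h0⟩ fun C hC => (le_div_iff₀ h).2 (hC n a u ha)

end

end TrigSum

/-!
The positivity of the McGehee–Pigno–Smith constant is proved by duality. The indices are cut into
blocks of size comparable to `4 ^ m`; each block carries a test polynomial `f_m` of sup norm at most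
`1` which has the conjugate phases of the coefficients, and whose `L²` norm is at most `2 ^ (-m)`.
By Stone–Weierstrass, `|f_m|` is approximated from above by the real part of an analytic polynomial
`P_m` (`exists_polynomial_re_approx`), whose `L²` norm is comparable with that of `f_m`
(`integral_norm_sq_eval_e_le`). The function `∑_j f_j exp (-ε ∑_{k > j} P_k)` is bounded, since the
factor `exp (-ε P_k)` is small where `f_k` is large (`norm_sum_mul_exp_le`). As the exponentials are
analytic, an earlier block does not contribute to the frequencies of a later one, and the later
blocks contribute little because the exponentials are close to `1` in `L²`
(`norm_integral_test_sub_le`). Pairing with this function yields `isMPSConstant_one_div`.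

For the lacunary inequality, all the convolution kernels are discrete measures on the `N`-th roots
of unity, whose multipliers are `N`-periodic and count differences between two intervals of
integers (`sum_intervalKernel_mul_e`). For intervals of lengths `d₂` and `d₂ - 2 d₁`, and
`N = q d₂`, the multiplier is a trapezoid which selects the indices `k ≡ s [ZMOD q]`; bounding the
two Dirichlet kernels pointwise shows that its normalised mass is `O(1 + log (1 + 2 / δ))`, so that
`F` may be replaced by its part over the residue class (`normL1_residueClass_le`). On that part the
characters `e (d₂ k t)` have, up to a common factor of modulus `1`, period `1 / (q d₂)`. Over a
window of this length the `f_k` vary little in `L¹`, by Bernstein's inequality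
(`normL1_trigPoly_sub_translate_le`, proved with the triangular multipliers of two equal
intervals), so the McGehee–Pigno–Smith inequality applies in the window to the frozen values `f_k t`
(`mpsConstant_mul_sum_le`).
-/

namespace TrigSum

/-! ### Additive characters and the `L¹` norm -/

theorem e_add (s t : ℝ) : e (s + t) = e s * e t := by
  simp only [e, ← Complex.exp_add]
  push_cast
  ring_nf

@[simp] theorem e_zero : e 0 = 1 := by simp [e]

@[simp] theorem norm_e (t : ℝ) : ‖e t‖ = 1 := by
  have : 2 * (Real.pi : ℂ) * Complex.I * (t : ℂ) = ((2 * Real.pi * t : ℝ) : ℂ) * Complex.I := by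
    push_cast
    ring
  rw [e, this, Complex.norm_exp_ofReal_mul_I]

theorem e_intCast (n : ℤ) : e (n : ℝ) = 1 := by
  rw [e, Complex.exp_eq_one_iff]
  exact ⟨n, by push_cast; ring⟩

theorem e_neg (t : ℝ) : e (-t) = (starRingEnd ℂ) (e t) := by
  have h2 : (starRingEnd ℂ) 2 = 2 := Complex.conj_ofNat 2
  simp [e, ← Complex.exp_conj, h2]

theorem e_natCast_mul (n : ℕ) (t : ℝ) : e ((n : ℝ) * t) = e t ^ n := by
  rw [e, e, ← Complex.exp_nat_mul]
  push_cast
  ring_nf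

@[fun_prop] theorem continuous_e : Continuous e := by
  unfold e
  fun_prop

theorem e_intCast_mul_add_one (n : ℤ) (t : ℝ) : e ((n : ℝ) * (t + 1)) = e ((n : ℝ) * t) := by
  rw [mul_add, mul_one, e_add, e_intCast, mul_one]

/-- Orthogonality of the characters `t ↦ e (n t)`. -/
theorem integral_e_intCast_mul (n : ℤ) :
    ∫ t in (0 : ℝ)..1, e ((n : ℝ) * t) = if n = 0 then 1 else 0 := by
  split_ifs with h
  · simp [h]
  · have hc : 2 * (Real.pi : ℂ) * Complex.I * (n : ℂ) ≠ 0 := by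
      simp [Real.pi_ne_zero, h]
    have h1 : ∀ t : ℝ, e ((n : ℝ) * t) = Complex.exp (2 * (Real.pi : ℂ) * Complex.I * n * t) := by
      intro t
      rw [e]
      push_cast
      ring_nf
    have h2 : Complex.exp (2 * (Real.pi : ℂ) * Complex.I * n) = 1 := by
      have := e_intCast n
      simpa [e] using this
    simp_rw [h1]
    rw [integral_exp_mul_complex hc]
    simp [h2]

/-- Mean value property of entire functions on the unit circle. -/
theorem integral_comp_e {G : ℂ → ℂ} (hG : Differentiable ℂ G) :
    ∫ t in (0 : ℝ)..1, G (e t) = G 0 := by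
  have h := DiffContOnCl.circleAverage (f := G) (c := 0) (R := 1) hG.diffContOnCl
  rw [Real.circleAverage] at h
  have h1 : ∀ t : ℝ, G (e t) = (fun θ : ℝ => G (circleMap 0 1 θ)) ((2 * Real.pi) * t) := by
    intro t
    simp only [circleMap, e]
    push_cast
    ring_nf
  rw [intervalIntegral.integral_congr fun t _ => h1 t,
    intervalIntegral.integral_comp_mul_left (fun θ : ℝ => G (circleMap 0 1 θ))
      Real.two_pi_pos.ne']
  simpa using h

/-- The `L¹` norm is invariant under translations. -/
theorem normL1_comp_add {f : ℝ → ℂ} (hf : Function.Periodic f 1) (x : ℝ) :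
    normL1 (fun t => f (t + x)) = normL1 f := by
  have hp : Function.Periodic (fun t => ‖f t‖) 1 := fun t => by simp only [hf t]
  have := hp.intervalIntegral_add_eq x 0
  rw [normL1, normL1, intervalIntegral.integral_comp_add_right (fun t => ‖f t‖)]
  simpa [add_comm] using this

theorem normL1_sum_le {ι : Type*} (s : Finset ι) {f : ι → ℝ → ℂ} (hf : ∀ i ∈ s, Continuous (f i)) :
    normL1 (fun t => ∑ i ∈ s, f i t) ≤ ∑ i ∈ s, normL1 (f i) := by
  simp only [normL1]
  rw [← intervalIntegral.integral_finsetSum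
    fun i hi => (hf i hi).norm.intervalIntegrable _ _]
  refine intervalIntegral.integral_mono_on zero_le_one ?_ ?_ fun t _ => norm_sum_le _ _
  · exact (continuous_finsetSum _ hf).norm.intervalIntegrable _ _
  · exact (continuous_finsetSum _ fun i hi => (hf i hi).norm).intervalIntegrable _ _

theorem normL1_const_mul (c : ℂ) (f : ℝ → ℂ) : normL1 (fun t => c * f t) = ‖c‖ * normL1 f := by
  simp [normL1]

/-- Convolution with a discrete measure is bounded on `L¹` by the total mass of the measure. -/
theorem normL1_sum_translates_le {ι : Type*} (s : Finset ι) (w : ι → ℂ) (x : ι → ℝ) {f : ℝ → ℂ}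
    (hf : Continuous f) (hp : Function.Periodic f 1) :
    normL1 (fun t => ∑ i ∈ s, w i * f (t + x i)) ≤ (∑ i ∈ s, ‖w i‖) * normL1 f := by
  refine (normL1_sum_le s fun i _ => by fun_prop).trans (le_of_eq ?_)
  rw [Finset.sum_mul]
  refine Finset.sum_congr rfl fun i _ => ?_
  rw [normL1_const_mul, normL1_comp_add hp]

section

open Polynomial

/-! ### Analytic polynomials on the unit circle -/

theorem norm_exp_sub_one_le_of_re_nonpos {z : ℂ} (hz : z.re ≤ 0) :
    ‖Complex.exp z - 1‖ ≤ ‖z‖ := by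
  have h := Convex.norm_image_sub_le_of_norm_deriv_le (𝕜 := ℂ) (f := Complex.exp) (C := 1)
    (s := {w : ℂ | w.re ≤ 0}) (x := 0) (y := z)
    (fun x _ => Complex.differentiableAt_exp)
    (fun x hx => by
      rw [Complex.deriv_exp, Complex.norm_exp]
      exact Real.exp_le_one_iff.2 hx)
    (convex_halfSpace_re_le 0) (by simp) hz
  simpa using h

/-- A linear combination of characters is, on the unit circle, a polynomial plus the complex
conjugate of a polynomial. -/
theorem exists_polynomial_add_conj {Q : C(AddCircle (1 : ℝ), ℂ)}
    (hQ : Q ∈ Submodule.span ℂ (Set.range (@fourier (1 : ℝ)))) :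
    ∃ P R : ℂ[X], ∀ t : ℝ, Q (t : AddCircle (1 : ℝ)) =
      P.eval (e t) + (starRingEnd ℂ) (R.eval (e t)) := by
  induction hQ using Submodule.span_induction with
  | mem x hx =>
    obtain ⟨n, rfl⟩ := hx
    have h1 : ∀ t : ℝ, fourier n (t : AddCircle (1 : ℝ)) = e ((n : ℝ) * t) := by
      intro t
      rw [fourier_coe_apply, e]
      push_cast
      ring_nf
    obtain ⟨m, rfl | rfl⟩ := n.eq_nat_or_neg
    · refine ⟨X ^ m, 0, fun t => ?_⟩
      rw [h1]
      simpa using e_natCast_mul m t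
    · refine ⟨0, X ^ m, fun t => ?_⟩
      rw [h1]
      simp only [eval_zero, zero_add, eval_pow, eval_X]
      rw [← e_natCast_mul, ← e_neg]
      push_cast
      ring_nf
  | zero => exact ⟨0, 0, fun t => by simp⟩
  | add x y _ _ hx hy =>
    obtain ⟨P, R, h⟩ := hx
    obtain ⟨P', R', h'⟩ := hy
    refine ⟨P + P', R + R', fun t => ?_⟩
    rw [ContinuousMap.add_apply, h, h']
    simp only [eval_add, map_add]
    ring
  | smul a x _ hx =>
    obtain ⟨P, R, h⟩ := hx
    refine ⟨C a * P, C ((starRingEnd ℂ) a) * R, fun t => ?_⟩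
    rw [ContinuousMap.smul_apply, h]
    simp
    ring

/-- A real continuous periodic function is approximated from above by the real part of an analytic
polynomial on the unit circle. -/
theorem exists_polynomial_re_approx {φ : ℝ → ℝ} (hφ : Continuous φ) (hp : Function.Periodic φ 1)
    {η : ℝ} (hη : 0 < η) :
    ∃ P : ℂ[X], (P.eval 0).im = 0 ∧
      ∀ t : ℝ, φ t ≤ (P.eval (e t)).re ∧ (P.eval (e t)).re ≤ φ t + η := by
  have : Fact ((0 : ℝ) < 1) := ⟨one_pos⟩
  have hp' : Function.Periodic (fun t => ((φ t + η / 2 : ℝ) : ℂ)) 1 := fun t => by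
    simp only [hp t]
  have hc : Continuous hp'.lift := by
    refine continuous_coinduced_dom.mpr ?_
    change Continuous fun t : ℝ => ((φ t + η / 2 : ℝ) : ℂ)
    fun_prop
  let g : C(AddCircle (1 : ℝ), ℂ) := ⟨hp'.lift, hc⟩
  have hg : g ∈ (Submodule.span ℂ (Set.range (@fourier (1 : ℝ)))).topologicalClosure := by
    rw [span_fourier_closure_eq_top]
    trivial
  obtain ⟨Q, hQ, hd⟩ := Metric.mem_closure_iff.1 hg (η / 2) (by positivity)
  obtain ⟨P, R, h⟩ := exists_polynomial_add_conj hQ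
  set z : ℂ := (P + R).eval 0
  refine ⟨P + R - C (z.im * Complex.I), by simp [z], fun t => ?_⟩
  have h1 : ‖g (t : AddCircle (1 : ℝ)) - Q (t : AddCircle (1 : ℝ))‖ < η / 2 := by
    rw [← dist_eq_norm]
    exact (ContinuousMap.dist_apply_le_dist _).trans_lt hd
  have h2 : g (t : AddCircle (1 : ℝ)) = ((φ t + η / 2 : ℝ) : ℂ) := hp'.lift_coe t
  have h3 := (Complex.abs_re_le_norm _).trans_lt h1
  rw [h2, h, Complex.sub_re, Complex.ofReal_re, Complex.add_re, Complex.conj_re, abs_lt] at h3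
  have h4 : ((P + R - C (z.im * Complex.I)).eval (e t)).re =
      (P.eval (e t)).re + (R.eval (e t)).re := by simp
  rw [h4]
  constructor <;> linarith

@[fun_prop]
theorem continuous_eval_e (P : ℂ[X]) : Continuous fun t => P.eval (e t) :=
  P.continuous.comp continuous_e

/-- The harmonic conjugate is bounded on `L²`: the `L²` norm of an analytic polynomial with real
constant term is controlled by that of its real part. -/
theorem integral_norm_sq_eval_e_le {P : ℂ[X]} (hP : (P.eval 0).im = 0) :
    ∫ t in (0 : ℝ)..1, ‖P.eval (e t)‖ ^ 2 ≤ 2 * ∫ t in (0 : ℝ)..1, (P.eval (e t)).re ^ 2 := by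
  have h1 : ∀ t : ℝ, ‖P.eval (e t)‖ ^ 2 =
      2 * (P.eval (e t)).re ^ 2 - (P.eval (e t) ^ 2).re := by
    intro t
    rw [Complex.sq_norm, Complex.normSq_apply, pow_two (P.eval (e t)), Complex.mul_re]
    ring
  have hc : Continuous fun t => P.eval (e t) ^ 2 := by fun_prop
  have h2 : ∫ t in (0 : ℝ)..1, (P.eval (e t) ^ 2).re = (P.eval 0).re ^ 2 := by
    have h3 := integral_comp_e (G := fun z => P.eval z ^ 2) (by fun_prop)
    have h4 := Complex.reCLM.intervalIntegral_comp_comm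
      (hc.intervalIntegrable (μ := MeasureTheory.volume) 0 1)
    simp only [Complex.reCLM_apply] at h4
    rw [h4, h3, pow_two, Complex.mul_re, hP]
    ring
  simp_rw [h1]
  rw [intervalIntegral.integral_sub, intervalIntegral.integral_const_mul, h2]
  · nlinarith [sq_nonneg (P.eval 0).re]
  · exact Continuous.intervalIntegrable (by fun_prop) _ _
  · exact Continuous.intervalIntegrable (by fun_prop) _ _

theorem sum_Ico_half_pow_le (j M : ℕ) :
    ∑ k ∈ Finset.Ico (j + 1) M, (1 / 2 : ℝ) ^ k ≤ (1 / 2) ^ j := by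
  refine (geom_sum_Ico_le_of_lt_one (by norm_num) (by norm_num)).trans (le_of_eq ?_)
  rw [pow_succ]
  ring

/-- Cauchy–Schwarz with geometric weights. -/
theorem norm_sum_Ico_sq_le (h : ℕ → ℂ) (j M : ℕ) :
    ‖∑ k ∈ Finset.Ico (j + 1) M, h k‖ ^ 2 ≤
      (1 / 2) ^ j * ∑ k ∈ Finset.Ico (j + 1) M, 2 ^ k * ‖h k‖ ^ 2 := by
  calc ‖∑ k ∈ Finset.Ico (j + 1) M, h k‖ ^ 2 ≤ (∑ k ∈ Finset.Ico (j + 1) M, ‖h k‖) ^ 2 := by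
        gcongr
        exact norm_sum_le _ _
    _ ≤ (∑ k ∈ Finset.Ico (j + 1) M, (1 / 2 : ℝ) ^ k) *
          ∑ k ∈ Finset.Ico (j + 1) M, 2 ^ k * ‖h k‖ ^ 2 := by
        refine Finset.sum_sq_le_sum_mul_sum_of_sq_le_mul _ (fun k _ => by positivity)
          (fun k _ => by positivity) fun k _ => le_of_eq ?_
        rw [← mul_assoc, ← mul_pow]
        norm_num
    _ ≤ _ := by
        gcongr
        exact sum_Ico_half_pow_le j M

/-- The character `e (n t)` with `n > 0` is orthogonal to the conjugates of analytic functions. -/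
theorem integral_e_mul_comp_e_eq_zero {G : ℂ → ℂ} (hG : Differentiable ℂ G) {n : ℤ} (hn : 0 < n) :
    ∫ t in (0 : ℝ)..1, e ((n : ℝ) * t) * G (e t) = 0 := by
  obtain ⟨m, rfl⟩ := Int.eq_ofNat_of_zero_le hn.le
  have hm : m ≠ 0 := by rintro rfl; simp at hn
  have h := integral_comp_e (G := fun z => z ^ m * G z) (by fun_prop)
  simp only [ne_eq, hm, not_false_eq_true, zero_pow, zero_mul] at h
  simpa [e_natCast_mul] using h

/-! ### The McGehee–Pigno–Smith inequality -/

/-- Parseval's identity for a finite exponential sum. -/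
theorem integral_norm_sq_sum_e {ι : Type*} (s : Finset ι) (c : ι → ℂ) {b : ι → ℤ}
    (hb : Function.Injective b) :
    ∫ t in (0 : ℝ)..1, ‖∑ i ∈ s, c i * e ((b i : ℝ) * t)‖ ^ 2 = ∑ i ∈ s, ‖c i‖ ^ 2 := by
  classical
  have h1 : ∀ t : ℝ, ((‖∑ i ∈ s, c i * e ((b i : ℝ) * t)‖ ^ 2 : ℝ) : ℂ) =
      ∑ i ∈ s, ∑ j ∈ s, c i * (starRingEnd ℂ) (c j) * e (((b i - b j : ℤ) : ℝ) * t) := by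
    intro t
    rw [Complex.ofReal_pow, ← Complex.mul_conj', map_sum, Finset.sum_mul_sum]
    refine Finset.sum_congr rfl fun i _ => Finset.sum_congr rfl fun j _ => ?_
    rw [map_mul, ← e_neg, Int.cast_sub, sub_mul, sub_eq_add_neg, e_add]
    ring
  apply Complex.ofReal_injective
  rw [← intervalIntegral.integral_ofReal]
  simp_rw [h1]
  rw [intervalIntegral.integral_finsetSum
    fun i _ => Continuous.intervalIntegrable (by fun_prop) _ _, Complex.ofReal_sum]
  refine Finset.sum_congr rfl fun i hi => ?_
  rw [intervalIntegral.integral_finsetSum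
    fun i _ => Continuous.intervalIntegrable (by fun_prop) _ _]
  simp_rw [intervalIntegral.integral_const_mul, integral_e_intCast_mul, sub_eq_zero, hb.eq_iff]
  simp [hi, Complex.mul_conj']

/-- The `m`-th block: the zero-based indices `j` with `4 ^ m ≤ j + 1 < 4 ^ (m + 1)`. -/
def mpsBlock (n m : ℕ) : Finset (Fin n) :=
  {j | Nat.log 4 ((j : ℕ) + 1) = m}

theorem mem_mpsBlock {n m : ℕ} {j : Fin n} :
    j ∈ mpsBlock n m ↔ Nat.log 4 ((j : ℕ) + 1) = m := by
  simp [mpsBlock]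

theorem card_mpsBlock_le (n m : ℕ) : (mpsBlock n m).card ≤ 3 * 4 ^ m := by
  have h : (mpsBlock n m).card ≤ (Finset.Ico (4 ^ m) (4 ^ (m + 1))).card := by
    refine Finset.card_le_card_of_injOn (fun j => (j : ℕ) + 1) (fun j hj => ?_) ?_
    · have hj' := mem_mpsBlock.1 hj
      subst hj'
      simp only [Finset.coe_Ico, Set.mem_Ico]
      exact ⟨Nat.pow_log_le_self 4 (Nat.succ_ne_zero _),
        Nat.lt_pow_succ_log_self (by norm_num) _⟩
    · intro i _ j _ hij
      exact Fin.ext (by simpa using hij)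
  rw [Nat.card_Ico, pow_succ] at h
  omega

/-- The normalised exponential sum with frequencies `-a j`, for `j` in the `m`-th block. -/
noncomputable def blockSum {n : ℕ} (a : Fin n → ℤ) (c : Fin n → ℂ) (m : ℕ) (t : ℝ) : ℂ :=
  1 / (3 * 4 ^ m) * ∑ j ∈ mpsBlock n m, c j * e (((-a j : ℤ) : ℝ) * t)

section

variable {n : ℕ} {a : Fin n → ℤ} {c : Fin n → ℂ}

@[fun_prop]
theorem continuous_blockSum (m : ℕ) : Continuous (blockSum a c m) := by
  unfold blockSum
  fun_prop

theorem blockSum_periodic (m : ℕ) : Function.Periodic (blockSum a c m) 1 := by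
  intro t
  simp only [blockSum, e_intCast_mul_add_one]

theorem norm_blockSum_le_one (hc : ∀ j, ‖c j‖ ≤ 1) (m : ℕ) (t : ℝ) : ‖blockSum a c m t‖ ≤ 1 := by
  have h : ‖∑ j ∈ mpsBlock n m, c j * e (((-a j : ℤ) : ℝ) * t)‖ ≤ 3 * 4 ^ m := by
    calc _ ≤ ∑ j ∈ mpsBlock n m, (1 : ℝ) := by
          refine norm_sum_le_of_le _ fun j _ => ?_
          rw [norm_mul, norm_e, mul_one]
          exact hc j
      _ = ((mpsBlock n m).card : ℝ) := by simp
      _ ≤ 3 * 4 ^ m := by exact_mod_cast card_mpsBlock_le n m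
  rw [blockSum, norm_mul]
  have h2 : ‖(1 / (3 * 4 ^ m) : ℂ)‖ = 1 / (3 * 4 ^ m) := by simp
  rw [h2, one_div_mul_eq_div, div_le_one (by positivity)]
  exact h

theorem integral_norm_sq_blockSum_le (ha : Function.Injective a) (hc : ∀ j, ‖c j‖ ≤ 1) (m : ℕ) :
    ∫ t in (0 : ℝ)..1, ‖blockSum a c m t‖ ^ 2 ≤ (1 / 4) ^ m := by
  have h2 : ‖(1 / (3 * 4 ^ m) : ℂ)‖ = 1 / (3 * 4 ^ m) := by simp
  simp_rw [blockSum, norm_mul, mul_pow, h2]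
  rw [intervalIntegral.integral_const_mul,
    integral_norm_sq_sum_e _ _ (b := fun j => -a j) fun i j hij => ha (neg_injective hij)]
  have h3 : ∑ j ∈ mpsBlock n m, ‖c j‖ ^ 2 ≤ 3 * 4 ^ m := by
    calc _ ≤ ∑ j ∈ mpsBlock n m, (1 : ℝ) :=
          Finset.sum_le_sum fun j _ => pow_le_one₀ (norm_nonneg _) (hc j)
      _ = ((mpsBlock n m).card : ℝ) := by simp
      _ ≤ 3 * 4 ^ m := by exact_mod_cast card_mpsBlock_le n m
  calc _ ≤ (1 / (3 * 4 ^ m) : ℝ) ^ 2 * (3 * 4 ^ m) := by gcongr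
    _ = (1 / 4) ^ m / 3 := by
        rw [one_div_pow (4 : ℝ)]
        field_simp
    _ ≤ (1 / 4) ^ m := div_le_self (by positivity) (by norm_num)

theorem integral_e_mul_blockSum (ha : Function.Injective a) (l : Fin n) (m : ℕ) :
    ∫ t in (0 : ℝ)..1, e ((a l : ℝ) * t) * blockSum a c m t =
      if Nat.log 4 ((l : ℕ) + 1) = m then 1 / (3 * 4 ^ m) * c l else 0 := by
  have h1 : ∀ t : ℝ, e ((a l : ℝ) * t) * blockSum a c m t =
      1 / (3 * 4 ^ m) * ∑ j ∈ mpsBlock n m, c j * e (((a l - a j : ℤ) : ℝ) * t) := by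
    intro t
    rw [blockSum, mul_left_comm, Finset.mul_sum]
    congr 1
    refine Finset.sum_congr rfl fun j _ => ?_
    rw [Int.cast_sub, sub_eq_add_neg, add_mul, e_add, Int.cast_neg]
    ring
  simp_rw [h1]
  rw [intervalIntegral.integral_const_mul, intervalIntegral.integral_finsetSum
    fun i _ => Continuous.intervalIntegrable (by fun_prop) _ _]
  simp_rw [intervalIntegral.integral_const_mul, integral_e_intCast_mul, sub_eq_zero, ha.eq_iff]
  simp [mem_mpsBlock]

/-- A block lying strictly before the index `l` is, after multiplication by an analytic function,
orthogonal to the frequency `a l`. -/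
theorem integral_e_mul_blockSum_mul_eq_zero (ha : StrictMono a) {G : ℂ → ℂ}
    (hG : Differentiable ℂ G) {l : Fin n} {m : ℕ} (hm : m < Nat.log 4 ((l : ℕ) + 1)) :
    ∫ t in (0 : ℝ)..1, e ((a l : ℝ) * t) * (blockSum a c m t * G (e t)) = 0 := by
  have h1 : ∀ t : ℝ, e ((a l : ℝ) * t) * (blockSum a c m t * G (e t)) =
      1 / (3 * 4 ^ m) * ∑ j ∈ mpsBlock n m,
        c j * (e (((a l - a j : ℤ) : ℝ) * t) * G (e t)) := by
    intro t
    rw [blockSum, mul_assoc, mul_left_comm, Finset.sum_mul, Finset.mul_sum]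
    congr 1
    refine Finset.sum_congr rfl fun j _ => ?_
    rw [Int.cast_sub, sub_eq_add_neg, add_mul, e_add, Int.cast_neg]
    ring
  have hGc : Continuous G := hG.continuous
  simp_rw [h1]
  rw [intervalIntegral.integral_const_mul, intervalIntegral.integral_finsetSum
    fun i _ => Continuous.intervalIntegrable (by fun_prop) _ _, Finset.sum_eq_zero, mul_zero]
  intro j hj
  have hjl : j < l := by
    by_contra! h
    have := Nat.log_mono_right (b := 4) (Nat.succ_le_succ h)
    rw [mem_mpsBlock] at hj
    simp only [Nat.succ_eq_add_one] at this
    omega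
  rw [intervalIntegral.integral_const_mul,
    integral_e_mul_comp_e_eq_zero hG (sub_pos.2 (ha hjl)), mul_zero]

end

/-- Multiplying by the damping factors `exp (-h k / 24)`, whose modulus is small exactly where
`z k` is large, keeps the successive partial sums bounded. -/
theorem norm_sum_mul_exp_le {z h : ℕ → ℂ} (hz : ∀ k, ‖z k‖ ≤ 1) (hh : ∀ k, ‖z k‖ ≤ (h k).re)
    (M : ℕ) :
    ‖∑ j ∈ Finset.range M,
      z j * Complex.exp (-(1 / 24) * ∑ k ∈ Finset.Ico (j + 1) M, h k)‖ ≤ 48 := by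
  induction M with
  | zero => simp
  | succ M ih =>
    have h1 : ∑ j ∈ Finset.range (M + 1),
          z j * Complex.exp (-(1 / 24) * ∑ k ∈ Finset.Ico (j + 1) (M + 1), h k) =
        (∑ j ∈ Finset.range M,
          z j * Complex.exp (-(1 / 24) * ∑ k ∈ Finset.Ico (j + 1) M, h k)) *
          Complex.exp (-(1 / 24) * h M) + z M := by
      rw [Finset.sum_range_succ, Finset.Ico_self, Finset.sum_empty, mul_zero, Complex.exp_zero,
        mul_one, Finset.sum_mul]
      congr 1
      refine Finset.sum_congr rfl fun j hj => ?_
      rw [Finset.sum_Ico_succ_top (by simpa [Nat.succ_le_iff] using hj), mul_add, Complex.exp_add,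
        mul_assoc]
    have h2 : ‖Complex.exp (-(1 / 24) * h M)‖ ≤ 1 - ‖z M‖ / 48 := by
      have h3 : (-(1 / 24) * h M).re ≤ -(‖z M‖ / 24) := by
        have h4 : (-(1 / 24) * h M).re = -(1 / 24) * (h M).re := by
          have : (-(1 / 24) : ℂ) = ((-(1 / 24) : ℝ) : ℂ) := by push_cast; ring
          rw [this, Complex.re_ofReal_mul]
        rw [h4]
        linarith [hh M]
      rw [Complex.norm_exp]
      refine (Real.exp_le_exp.2 h3).trans ?_
      have hy := norm_nonneg (z M)
      have hy1 := hz M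
      rw [Real.exp_neg, inv_le_iff_one_le_mul₀ (Real.exp_pos _)]
      have h5 := Real.add_one_le_exp (‖z M‖ / 24)
      nlinarith
    rw [h1]
    refine (norm_add_le _ _).trans ?_
    rw [norm_mul]
    have h6 := mul_le_mul ih h2 (norm_nonneg _) (by norm_num)
    linarith

/-- The test function of the McGehee–Pigno–Smith argument pairs with the frequency `a l` almost as
the block containing `l` does. -/
theorem norm_integral_test_sub_le {n : ℕ} {a : Fin n → ℤ} {c : Fin n → ℂ} (ha : StrictMono a)
    (hc : ∀ j, ‖c j‖ ≤ 1) {P : ℕ → ℂ[X]} (hP0 : ∀ k t, 0 ≤ ((P k).eval (e t)).re)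
    (hP : ∀ k, ∫ t in (0 : ℝ)..1, ‖(P k).eval (e t)‖ ^ 2 ≤ 8 * (1 / 4) ^ k)
    (l : Fin n) {M : ℕ} (hM : Nat.log 4 ((l : ℕ) + 1) < M) :
    ‖(∫ t in (0 : ℝ)..1, e ((a l : ℝ) * t) * ∑ j ∈ Finset.range M,
        blockSum a c j t *
          Complex.exp (-(1 / 24) * ∑ k ∈ Finset.Ico (j + 1) M, (P k).eval (e t))) -
      1 / (3 * 4 ^ Nat.log 4 ((l : ℕ) + 1)) * c l‖ ≤ (1 / 4) ^ Nat.log 4 ((l : ℕ) + 1) / 6 := by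
  set m := Nat.log 4 ((l : ℕ) + 1) with hm
  -- the `j`-th damping factor as an entire function
  set G : ℕ → ℂ → ℂ := fun j z =>
    Complex.exp (-(1 / 24) * ∑ k ∈ Finset.Ico (j + 1) M, (P k).eval z) with hG
  have hGd : ∀ j, Differentiable ℂ (G j) := fun j => by
    simp only [hG]
    fun_prop
  have hGc : ∀ j, Continuous (G j) := fun j => (hGd j).continuous
  -- the deviation of the `j`-th damping factor from `1` is small in `L²`
  have hG1 : ∀ j, ∫ t in (0 : ℝ)..1, ‖G j (e t) - 1‖ ^ 2 ≤ (1 / 24) ^ 2 * (8 * (1 / 4) ^ j) := by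
    intro j
    have h1 : ∀ t, ‖G j (e t) - 1‖ ^ 2 ≤ (1 / 24) ^ 2 *
        ((1 / 2) ^ j * ∑ k ∈ Finset.Ico (j + 1) M, 2 ^ k * ‖(P k).eval (e t)‖ ^ 2) := by
      intro t
      have h2 : (-(1 / 24) * ∑ k ∈ Finset.Ico (j + 1) M, (P k).eval (e t)).re ≤ 0 := by
        have : (-(1 / 24) : ℂ) = ((-(1 / 24) : ℝ) : ℂ) := by push_cast; ring
        rw [this, Complex.re_ofReal_mul, Complex.re_sum]
        have := Finset.sum_nonneg fun k (_ : k ∈ Finset.Ico (j + 1) M) => hP0 k t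
        linarith
      have h3 := norm_exp_sub_one_le_of_re_nonpos h2
      rw [norm_mul] at h3
      have h4 : ‖(-(1 / 24) : ℂ)‖ = 1 / 24 := by simp
      rw [h4] at h3
      calc _ ≤ (1 / 24 * ‖∑ k ∈ Finset.Ico (j + 1) M, (P k).eval (e t)‖) ^ 2 := by gcongr
        _ ≤ _ := by
          rw [mul_pow]
          gcongr
          exact norm_sum_Ico_sq_le _ j M
    have hi : ∀ k, IntervalIntegrable (fun t => 2 ^ k * ‖(P k).eval (e t)‖ ^ 2)
        MeasureTheory.volume 0 1 := fun k => Continuous.intervalIntegrable (by fun_prop) _ _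
    calc _ ≤ ∫ t in (0 : ℝ)..1, (1 / 24) ^ 2 * ((1 / 2) ^ j *
            ∑ k ∈ Finset.Ico (j + 1) M, 2 ^ k * ‖(P k).eval (e t)‖ ^ 2) := by
          refine intervalIntegral.integral_mono_on zero_le_one ?_ ?_ fun t _ => h1 t
          · have := hGc j
            exact Continuous.intervalIntegrable (by fun_prop) _ _
          · exact Continuous.intervalIntegrable (by fun_prop) _ _
      _ = (1 / 24) ^ 2 * ((1 / 2) ^ j *
            ∑ k ∈ Finset.Ico (j + 1) M, 2 ^ k * ∫ t in (0 : ℝ)..1, ‖(P k).eval (e t)‖ ^ 2) := by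
          rw [intervalIntegral.integral_const_mul, intervalIntegral.integral_const_mul,
            intervalIntegral.integral_finsetSum fun k _ => hi k]
          simp_rw [intervalIntegral.integral_const_mul]
      _ ≤ (1 / 24) ^ 2 * ((1 / 2) ^ j *
            ∑ k ∈ Finset.Ico (j + 1) M, 2 ^ k * (8 * (1 / 4) ^ k)) := by
          gcongr with k _
          exact hP k
      _ = (1 / 24) ^ 2 * (8 * ((1 / 2) ^ j * ∑ k ∈ Finset.Ico (j + 1) M, (1 / 2) ^ k)) := by
          have : ∀ k : ℕ, (2 : ℝ) ^ k * (8 * (1 / 4) ^ k) = 8 * (1 / 2) ^ k := fun k => by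
            rw [mul_left_comm, ← mul_pow]
            norm_num
          simp_rw [this, ← Finset.mul_sum]
          ring
      _ ≤ (1 / 24) ^ 2 * (8 * ((1 / 2) ^ j * (1 / 2) ^ j)) := by
          gcongr
          exact sum_Ico_half_pow_le j M
      _ = _ := by
          rw [← mul_pow]
          norm_num
  have hcont : ∀ j, Continuous fun t => e ((a l : ℝ) * t) * (blockSum a c j t * G j (e t)) := by
    intro j
    have := hGc j
    fun_prop
  have hterm : ∀ j, ‖(∫ t in (0 : ℝ)..1, e ((a l : ℝ) * t) * (blockSum a c j t * G j (e t))) -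
      (if m = j then 1 / (3 * 4 ^ j) * c l else 0)‖ ≤
        if m ≤ j then 1 / 8 * (1 / 4) ^ j else 0 := by
    intro j
    rcases lt_or_ge j m with h | h
    · rw [integral_e_mul_blockSum_mul_eq_zero ha (hGd j) h, if_neg h.ne', if_neg (not_le.2 h)]
      simp
    · have hi1 : Continuous fun t => ‖blockSum a c j t‖ ^ 2 := by fun_prop
      have hi2 : Continuous fun t => ‖G j (e t) - 1‖ ^ 2 := by
        have := hGc j
        fun_prop
      rw [if_pos h, ← integral_e_mul_blockSum ha.injective l j, ← intervalIntegral.integral_sub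
        ((hcont j).intervalIntegrable _ _) (Continuous.intervalIntegrable (by fun_prop) _ _)]
      refine (intervalIntegral.norm_integral_le_integral_norm zero_le_one).trans ?_
      -- the weights `1 / 16` and `4` balance the two `L²` bounds
      calc _ ≤ ∫ t in (0 : ℝ)..1,
              (1 / 16 * ‖blockSum a c j t‖ ^ 2 + 4 * ‖G j (e t) - 1‖ ^ 2) := by
            refine intervalIntegral.integral_mono_on zero_le_one ?_ ?_ fun t _ => ?_
            · have := hcont j
              exact Continuous.intervalIntegrable (by fun_prop) _ _
            · exact Continuous.intervalIntegrable (by fun_prop) _ _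
            · rw [← mul_sub, ← mul_sub_one, norm_mul, norm_e, norm_mul, one_mul]
              nlinarith [sq_nonneg (‖blockSum a c j t‖ / 4 - 2 * ‖G j (e t) - 1‖)]
        _ = 1 / 16 * (∫ t in (0 : ℝ)..1, ‖blockSum a c j t‖ ^ 2) +
              4 * ∫ t in (0 : ℝ)..1, ‖G j (e t) - 1‖ ^ 2 := by
            rw [intervalIntegral.integral_add
              (Continuous.intervalIntegrable (by fun_prop) _ _)
              (Continuous.intervalIntegrable (by fun_prop) _ _),
              intervalIntegral.integral_const_mul, intervalIntegral.integral_const_mul]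
        _ ≤ 1 / 16 * (1 / 4) ^ j + 4 * ((1 / 24) ^ 2 * (8 * (1 / 4) ^ j)) := by
            gcongr
            · exact integral_norm_sq_blockSum_le ha.injective hc j
            · exact hG1 j
        _ ≤ 1 / 8 * (1 / 4) ^ j := by
            have : (0 : ℝ) < (1 / 4) ^ j := by positivity
            linarith
  have hint : (∫ t in (0 : ℝ)..1, e ((a l : ℝ) * t) * ∑ j ∈ Finset.range M,
        blockSum a c j t *
          Complex.exp (-(1 / 24) * ∑ k ∈ Finset.Ico (j + 1) M, (P k).eval (e t))) =
      ∑ j ∈ Finset.range M,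
        ∫ t in (0 : ℝ)..1, e ((a l : ℝ) * t) * (blockSum a c j t * G j (e t)) := by
    rw [← intervalIntegral.integral_finsetSum
      fun j _ => (hcont j).intervalIntegrable (μ := MeasureTheory.volume) 0 1]
    simp only [Finset.mul_sum, hG]
  have hmain : 1 / (3 * 4 ^ m) * c l =
      ∑ j ∈ Finset.range M, if m = j then 1 / (3 * 4 ^ j) * c l else 0 := by
    rw [Finset.sum_ite_eq, if_pos (Finset.mem_range.2 hM)]
  rw [hint, hmain, ← Finset.sum_sub_distrib]
  calc _ ≤ ∑ j ∈ Finset.range M, if m ≤ j then 1 / 8 * (1 / 4 : ℝ) ^ j else 0 :=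
        norm_sum_le_of_le _ fun j _ => hterm j
    _ = 1 / 8 * ∑ j ∈ Finset.Ico m M, (1 / 4 : ℝ) ^ j := by
        rw [← Finset.sum_filter, Finset.mul_sum]
        congr 1
        ext j
        simp [and_comm]
    _ ≤ 1 / 8 * ((1 / 4) ^ m / (1 - 1 / 4)) := by
        gcongr
        exact geom_sum_Ico_le_of_lt_one (by norm_num) (by norm_num)
    _ = (1 / 4) ^ m / 6 := by ring

/-- The McGehee–Pigno–Smith inequality with an explicit constant. -/
theorem isMPSConstant_one_div : IsMPSConstant (1 / 288) := by
  intro n a u ha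
  -- the phases of the coefficients
  set c : Fin n → ℂ := fun j => (starRingEnd ℂ) (u j) / ‖u j‖ with hc_def
  have hc : ∀ j, ‖c j‖ ≤ 1 := fun j => by
    simp only [hc_def, norm_div, RCLike.norm_conj, Complex.norm_real, norm_norm]
    exact div_self_le_one _
  have huc : ∀ j, u j * c j = ‖u j‖ := fun j => by
    rw [hc_def]
    by_cases h : u j = 0
    · simp [h]
    · have : (‖u j‖ : ℂ) ≠ 0 := by simpa using h
      rw [← mul_div_assoc, Complex.mul_conj', pow_two, mul_div_assoc, div_self this, mul_one]
  have hex : ∀ k, ∃ P : ℂ[X], (P.eval 0).im = 0 ∧ ∀ t : ℝ, ‖blockSum a c k t‖ ≤ (P.eval (e t)).re ∧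
      (P.eval (e t)).re ≤ ‖blockSum a c k t‖ + (1 / 2) ^ k := fun k =>
    exists_polynomial_re_approx (by fun_prop) (fun t => by rw [blockSum_periodic]) (by positivity)
  choose P hPi hPb using hex
  have hP0 : ∀ k t, 0 ≤ ((P k).eval (e t)).re := fun k t => (norm_nonneg _).trans (hPb k t).1
  have hP : ∀ k, ∫ t in (0 : ℝ)..1, ‖(P k).eval (e t)‖ ^ 2 ≤ 8 * (1 / 4) ^ k := by
    intro k
    have h1 : ∫ t in (0 : ℝ)..1, ((P k).eval (e t)).re ^ 2 ≤
        ∫ t in (0 : ℝ)..1, (2 * ‖blockSum a c k t‖ ^ 2 + 2 * (1 / 4) ^ k) := by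
      refine intervalIntegral.integral_mono_on zero_le_one
        (Continuous.intervalIntegrable (by fun_prop) _ _)
        (Continuous.intervalIntegrable (by fun_prop) _ _) fun t _ => ?_
      have h2 : ((P k).eval (e t)).re ^ 2 ≤ (‖blockSum a c k t‖ + (1 / 2) ^ k) ^ 2 :=
        pow_le_pow_left₀ (hP0 k t) (hPb k t).2 2
      have h3 : ((1 / 4 : ℝ)) ^ k = ((1 / 2) ^ k) ^ 2 := by
        rw [← pow_mul, mul_comm, pow_mul]
        norm_num
      rw [h3]
      nlinarith [sq_nonneg (‖blockSum a c k t‖ - (1 / 2) ^ k)]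
    rw [intervalIntegral.integral_add (Continuous.intervalIntegrable (by fun_prop) _ _)
      (Continuous.intervalIntegrable (by fun_prop) _ _),
      intervalIntegral.integral_const_mul] at h1
    have h4 := integral_norm_sq_blockSum_le ha.injective hc k
    have h5 := integral_norm_sq_eval_e_le (hPi k)
    simp only [intervalIntegral.integral_const, sub_zero, one_smul] at h1
    linarith
  set f : ℝ → ℂ := fun t => ∑ j : Fin n, u j * e ((a j : ℝ) * t) with hf
  set T : ℝ → ℂ := fun t => ∑ j ∈ Finset.range n, blockSum a c j t *
    Complex.exp (-(1 / 24) * ∑ k ∈ Finset.Ico (j + 1) n, (P k).eval (e t)) with hT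
  have hTc : Continuous T := by
    rw [hT]
    fun_prop
  have hTb : ∀ t, ‖T t‖ ≤ 48 := fun t =>
    norm_sum_mul_exp_le (fun k => norm_blockSum_le_one hc k t) (fun k => (hPb k t).1) n
  have hup : ‖∫ t in (0 : ℝ)..1, f t * T t‖ ≤ 48 * normL1 f := by
    refine (intervalIntegral.norm_integral_le_integral_norm zero_le_one).trans ?_
    rw [normL1, ← intervalIntegral.integral_const_mul]
    refine intervalIntegral.integral_mono_on zero_le_one
      (Continuous.intervalIntegrable (by fun_prop) _ _)
      (Continuous.intervalIntegrable (by fun_prop) _ _) fun t _ => ?_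
    rw [norm_mul, mul_comm]
    gcongr
    exact hTb t
  have hlow : ∀ l : Fin n, ‖u l‖ / ((l : ℝ) + 1) / 6 ≤
      (u l * ∫ t in (0 : ℝ)..1, e ((a l : ℝ) * t) * T t).re := by
    intro l
    have hl : Nat.log 4 ((l : ℕ) + 1) < n :=
      (Nat.log_lt_self 4 (Nat.succ_ne_zero _)).trans_le l.2
    have h1 := norm_integral_test_sub_le ha hc hP0 hP l hl
    set m := Nat.log 4 ((l : ℕ) + 1) with hm
    set z := (∫ t in (0 : ℝ)..1, e ((a l : ℝ) * t) * T t) - 1 / (3 * 4 ^ m) * c l with hz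
    have h2 : (u l * ∫ t in (0 : ℝ)..1, e ((a l : ℝ) * t) * T t) =
        ((1 / 4 : ℝ) ^ m / 3 * ‖u l‖ : ℝ) + u l * z := by
      rw [hz, mul_sub, mul_left_comm (u l), huc]
      push_cast
      rw [one_div_pow]
      field_simp
      ring
    have h3 : -(‖u l‖ * ((1 / 4) ^ m / 6)) ≤ (u l * z).re := by
      have h4 := (abs_le.1 (Complex.abs_re_le_norm (u l * z))).1
      rw [norm_mul] at h4
      have h5 := mul_le_mul_of_nonneg_left h1 (norm_nonneg (u l))
      linarith
    have h6 : 1 / ((l : ℝ) + 1) ≤ (1 / 4) ^ m := by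
      rw [one_div_pow]
      have h7 : (4 : ℝ) ^ m ≤ (l : ℝ) + 1 := by
        exact_mod_cast Nat.pow_log_le_self 4 (Nat.succ_ne_zero (l : ℕ))
      gcongr
    have h8 := mul_le_mul_of_nonneg_left h6 (norm_nonneg (u l))
    rw [h2, Complex.add_re, Complex.ofReal_re]
    rw [mul_one_div] at h8
    linarith
  have hsum : ∫ t in (0 : ℝ)..1, f t * T t =
      ∑ l : Fin n, u l * ∫ t in (0 : ℝ)..1, e ((a l : ℝ) * t) * T t := by
    simp_rw [hf, Finset.sum_mul, mul_assoc]
    rw [intervalIntegral.integral_finsetSum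
      fun i _ => Continuous.intervalIntegrable (by fun_prop) _ _]
    simp_rw [intervalIntegral.integral_const_mul]
  have h1 := (Complex.re_le_norm _).trans hup
  rw [hsum, Complex.re_sum] at h1
  have h2 := Finset.sum_le_sum fun l (_ : l ∈ Finset.univ) => hlow l
  rw [← Finset.sum_div] at h2
  linarith

theorem mpsConstant_pos : 0 < mpsConstant :=
  lt_of_lt_of_le (by norm_num) (isGreatest_mpsConstant.2 isMPSConstant_one_div)

end

/-! ### Dirichlet sums and discrete kernels -/

theorem e_eq_one_iff {t : ℝ} : e t = 1 ↔ ∃ n : ℤ, t = n := by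
  constructor
  · intro h
    obtain ⟨n, hn⟩ := Complex.exp_eq_one_iff.1 h
    refine ⟨n, ?_⟩
    have h1 : (t : ℂ) * (2 * (Real.pi : ℂ) * Complex.I) = n * (2 * (Real.pi : ℂ) * Complex.I) := by
      rw [← hn]
      ring
    exact_mod_cast mul_right_cancel₀ Complex.two_pi_I_ne_zero h1
  · rintro ⟨n, rfl⟩
    exact e_intCast n

/-- Orthogonality of the additive characters of `ℤ / N`. -/
theorem sum_range_e_mul_div {N : ℕ} (hN : 0 < N) (ν : ℤ) :
    ∑ l ∈ Finset.range N, e ((ν : ℝ) * ((l : ℝ) / N)) = if (N : ℤ) ∣ ν then (N : ℂ) else 0 := by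
  have hN' : (N : ℝ) ≠ 0 := by positivity
  have h1 : ∀ l : ℕ, e ((ν : ℝ) * ((l : ℝ) / N)) = e ((ν : ℝ) / N) ^ l := by
    intro l
    rw [← e_natCast_mul]
    ring_nf
  have h2 : e ((ν : ℝ) / N) = 1 ↔ (N : ℤ) ∣ ν := by
    rw [e_eq_one_iff]
    refine exists_congr fun n => ?_
    rw [div_eq_iff hN', mul_comm]
    exact_mod_cast Iff.rfl
  simp_rw [h1]
  split_ifs with h
  · simp [h2.2 h]
  · have h3 : e ((ν : ℝ) / N) ≠ 1 := fun hh => h (h2.1 hh)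
    rw [geom_sum_eq h3, ← e_natCast_mul, mul_div_cancel₀ _ hN', e_intCast, sub_self, zero_div]

/-- The exponential sum over the interval of integers `α, ..., α + L - 1`. -/
noncomputable def dirichletSum (α : ℤ) (L : ℕ) (x : ℝ) : ℂ :=
  ∑ i ∈ Finset.range L, e (((α + i : ℤ) : ℝ) * x)

/-- The density, at the point `l / N`, of a discrete measure on the circle whose Fourier multiplier
counts the differences between two intervals of integers modulo `N`
(see `sum_intervalKernel_mul_e`). -/
noncomputable def intervalKernel (N : ℕ) (α : ℤ) (L L' l : ℕ) : ℂ :=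
  1 / N * ((starRingEnd ℂ) (dirichletSum α L ((l : ℝ) / N)) * dirichletSum 0 L' ((l : ℝ) / N))

theorem sum_intervalKernel_mul_e {N : ℕ} (hN : 0 < N) (α : ℤ) (L L' : ℕ) (ν : ℤ) :
    ∑ l ∈ Finset.range N, intervalKernel N α L L' l * e ((ν : ℝ) * ((l : ℝ) / N)) =
      ∑ j ∈ Finset.range L', ∑ i ∈ Finset.range L,
        if (N : ℤ) ∣ ν - (α + i) + j then (1 : ℂ) else 0 := by
  have hN' : (N : ℂ) ≠ 0 := by exact_mod_cast hN.ne'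
  have h1 : ∀ l : ℕ, intervalKernel N α L L' l * e ((ν : ℝ) * ((l : ℝ) / N)) =
      ∑ j ∈ Finset.range L', ∑ i ∈ Finset.range L,
        1 / N * e (((ν - (α + i) + j : ℤ) : ℝ) * ((l : ℝ) / N)) := by
    intro l
    rw [intervalKernel, dirichletSum, dirichletSum, map_sum, mul_comm (∑ i ∈ _, _),
      Finset.sum_mul_sum, mul_assoc, Finset.sum_mul, Finset.mul_sum]
    refine Finset.sum_congr rfl fun j _ => ?_
    rw [Finset.sum_mul, Finset.mul_sum]
    refine Finset.sum_congr rfl fun i _ => ?_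
    rw [← e_neg, ← e_add, ← e_add]
    push_cast
    ring_nf
  simp_rw [h1]
  rw [Finset.sum_comm]
  refine Finset.sum_congr rfl fun j _ => ?_
  rw [Finset.sum_comm]
  refine Finset.sum_congr rfl fun i _ => ?_
  rw [← Finset.mul_sum, sum_range_e_mul_div hN]
  split_ifs
  · exact one_div_mul_cancel hN'
  · simp

theorem norm_dirichletSum_le (α : ℤ) (L : ℕ) (x : ℝ) : ‖dirichletSum α L x‖ ≤ L := by
  refine (norm_sum_le _ _).trans ?_
  simp

theorem norm_dirichletSum_mul_le (α : ℤ) (L : ℕ) (x : ℝ) :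
    ‖dirichletSum α L x‖ * ‖e x - 1‖ ≤ 2 := by
  have h : dirichletSum α L x * (e x - 1) = e (((α + L : ℤ) : ℝ) * x) - e ((α : ℝ) * x) := by
    have h1 := Finset.sum_range_sub (fun i : ℕ => e (((α + i : ℤ) : ℝ) * x)) L
    simp only [Nat.cast_zero, add_zero] at h1
    rw [← h1, dirichletSum, Finset.sum_mul]
    refine Finset.sum_congr rfl fun i _ => ?_
    rw [mul_sub, mul_one, ← e_add]
    push_cast
    ring_nf
  rw [← norm_mul, h]
  refine (norm_sub_le _ _).trans ?_
  rw [norm_e, norm_e]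
  norm_num

theorem four_mul_le_norm_e_sub_one {x : ℝ} (h0 : 0 ≤ x) (h1 : x ≤ 1 / 2) :
    4 * x ≤ ‖e x - 1‖ := by
  have h2 : e x = Complex.exp (Complex.I * ((2 * Real.pi * x : ℝ) : ℂ)) := by
    rw [e]
    push_cast
    ring_nf
  have hpi := Real.pi_pos
  have h3 := Real.mul_le_sin (x := Real.pi * x) (by positivity) (by nlinarith)
  have h4 : 2 / Real.pi * (Real.pi * x) = 2 * x := by field_simp
  have h5 : 2 * Real.pi * x / 2 = Real.pi * x := by ring
  rw [h2, Complex.norm_exp_I_mul_ofReal_sub_one, h5]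
  refine le_trans ?_ (le_abs_self _)
  linarith

theorem four_mul_min_le_norm_e_sub_one {x : ℝ} (h0 : 0 ≤ x) (h1 : x ≤ 1) :
    4 * min x (1 - x) ≤ ‖e x - 1‖ := by
  rcases le_total x (1 / 2) with h | h
  · rw [min_eq_left (by linarith)]
    exact four_mul_le_norm_e_sub_one h0 h
  · rw [min_eq_right (by linarith)]
    have h2 := four_mul_le_norm_e_sub_one (x := 1 - x) (by linarith) (by linarith)
    have h3 : e (1 - x) - 1 = (starRingEnd ℂ) (e x - 1) := by
      have h4 := e_intCast 1
      rw [Int.cast_one] at h4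
      rw [sub_eq_add_neg 1 x, e_add, h4, one_mul, e_neg, map_sub, map_one]
    rwa [h3, RCLike.norm_conj] at h2

/-- The terms bounding the mass of the trapezoidal kernel are dominated by the differences of the
decreasing sequence `2 * log (1 + r / (l + p))`, so that their sum telescopes. -/
theorem div_mul_le_log_sub_log {p r l : ℝ} (hp : 0 < p) (hr : p ≤ r) (hl : 1 ≤ l) :
    r / ((l + p) * (l + r)) ≤
      2 * (Real.log (1 + r / (l - 1 + p)) - Real.log (1 + r / (l + p))) := by
  have hr0 : 0 < r := hp.trans_le hr
  have h1 : 0 < l - 1 + p := by linarith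
  have h2 : 0 < l + p := by linarith
  have h3 : 0 < l - 1 + p + r := by linarith
  rw [← Real.log_div (by positivity) (by positivity)]
  have h4 : (1 + r / (l - 1 + p)) / (1 + r / (l + p)) =
      (1 - r / ((l + p) * (l - 1 + p + r)))⁻¹ := by
    have h5 : 1 - r / ((l + p) * (l - 1 + p + r)) =
        (l - 1 + p) * (l + p + r) / ((l + p) * (l - 1 + p + r)) := by
      field_simp
      ring
    rw [h5, inv_div]
    field_simp
  have h6 : 0 < 1 - r / ((l + p) * (l - 1 + p + r)) := by
    rw [sub_pos, div_lt_one (by positivity)]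
    nlinarith
  rw [h4, Real.log_inv]
  have h7 := Real.log_le_sub_one_of_pos h6
  have h8 : r / ((l + p) * (l + r)) ≤ 2 * (r / ((l + p) * (l - 1 + p + r))) := by
    rw [← mul_div_assoc, div_le_div_iff₀ (by positivity) (by positivity)]
    have : l - 1 + p + r ≤ 2 * (l + r) := by linarith
    have h9 := mul_le_mul_of_nonneg_left this (show 0 ≤ r * (l + p) by positivity)
    nlinarith
  linarith

theorem sum_div_mul_le_log {p r : ℝ} (hp : 0 < p) (hr : p ≤ r) (n : ℕ) :
    ∑ l ∈ Finset.range n, r / (((l : ℝ) + 1 + p) * ((l : ℝ) + 1 + r)) ≤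
      2 * Real.log (1 + r / p) := by
  have hr0 : 0 < r := hp.trans_le hr
  have h1 : ∀ l ∈ Finset.range n, r / (((l : ℝ) + 1 + p) * ((l : ℝ) + 1 + r)) ≤
      2 * Real.log (1 + r / ((l : ℝ) + p)) - 2 * Real.log (1 + r / (((l + 1 : ℕ) : ℝ) + p)) := by
    intro l _
    have h2 := div_mul_le_log_sub_log hp hr (l := (l : ℝ) + 1) (by linarith [l.cast_nonneg (α := ℝ)])
    rw [add_sub_cancel_right] at h2
    push_cast
    linarith
  refine (Finset.sum_le_sum h1).trans ?_
  rw [Finset.sum_range_sub' (fun l : ℕ => 2 * Real.log (1 + r / ((l : ℝ) + p)))]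
  have h3 : 0 ≤ Real.log (1 + r / ((n : ℝ) + p)) := Real.log_nonneg (by
    have : 0 ≤ r / ((n : ℝ) + p) := by positivity
    linarith)
  simp only [Nat.cast_zero, zero_add]
  linarith

/-- The mass of `intervalKernel` grows only logarithmically with the ratio of the lengths of the
two intervals. -/
theorem sum_norm_intervalKernel_le {N L L' : ℕ} (hL' : 0 < L') (hLL : L' ≤ L) (hL : L ≤ N)
    (α : ℤ) :
    ∑ l ∈ Finset.range N, ‖intervalKernel N α L L' l‖ ≤
      L' * (1 + 9 * Real.log (1 + (L : ℝ) / L')) := by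
  have hL0 : 0 < L := hL'.trans_le hLL
  have hN : 0 < N := hL0.trans_le hL
  have hNr : (0 : ℝ) < N := by exact_mod_cast hN
  have hLr : (0 : ℝ) < L := by exact_mod_cast hL0
  have hL'r : (0 : ℝ) < L' := by exact_mod_cast hL'
  obtain ⟨M, rfl⟩ : ∃ M, N = M + 1 := ⟨N - 1, by omega⟩
  set N : ℝ := ((M + 1 : ℕ) : ℝ) with hNdef
  set p : ℝ := N / L with hp_def
  set r : ℝ := N / L' with hr_def
  have hp : 0 < p := by positivity
  have hr : 0 < r := by positivity
  have hpr : p ≤ r := by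
    rw [hp_def, hr_def]
    gcongr
  set g : ℝ → ℝ := fun μ => 9 / 4 * L' * (r / ((μ + p) * (μ + r))) with hg
  have hg0 : ∀ μ, 0 ≤ μ → 0 ≤ g μ := fun μ hμ => by
    simp only [hg]
    positivity
  have hnorm : ∀ l, ‖intervalKernel (M + 1) α L L' l‖ =
      1 / N * (‖dirichletSum α L ((l : ℝ) / N)‖ * ‖dirichletSum 0 L' ((l : ℝ) / N)‖) := by
    intro l
    rw [intervalKernel, norm_mul, norm_mul, RCLike.norm_conj, norm_div, norm_one,
      Complex.norm_natCast]
  have hzero : ‖intervalKernel (M + 1) α L L' 0‖ ≤ L' := by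
    have h1 : 1 / N * ((L : ℝ) * L') ≤ L' := by
      have hLN : (L : ℝ) ≤ N := by
        rw [hNdef]
        exact_mod_cast hL
      rw [one_div_mul_eq_div, div_le_iff₀ hNr, mul_comm (L' : ℝ)]
      gcongr
    rw [hnorm]
    refine le_trans ?_ h1
    gcongr <;> exact norm_dirichletSum_le _ _ _
  -- the trivial bound and the geometric series bound together
  have hD : ∀ (β : ℤ) (K : ℕ), 0 < K → ∀ x μ : ℝ, 0 ≤ μ → 4 * (μ / N) ≤ ‖e x - 1‖ →
      ‖dirichletSum β K x‖ ≤ 3 / 2 * N / (μ + N / K) := by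
    intro β K hK x μ hμ hx
    have hKr : (0 : ℝ) < K := by exact_mod_cast hK
    have h1 := norm_dirichletSum_le β K x
    have h2 := (mul_le_mul_of_nonneg_left hx (norm_nonneg (dirichletSum β K x))).trans
      (norm_dirichletSum_mul_le β K x)
    rw [le_div_iff₀ (by positivity), mul_add]
    have h3 : ‖dirichletSum β K x‖ * (N / K) ≤ K * (N / K) := by gcongr
    rw [mul_div_cancel₀ _ hKr.ne'] at h3
    have h4 : ‖dirichletSum β K x‖ * μ ≤ N / 2 := by
      have : ‖dirichletSum β K x‖ * (4 * (μ / N)) =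
        ‖dirichletSum β K x‖ * μ * 4 / N := by ring
      rw [this, div_le_iff₀ hNr] at h2
      linarith
    linarith
  have hsucc : ∀ l ∈ Finset.range M, ‖intervalKernel (M + 1) α L L' (l + 1)‖ ≤
      g ((l : ℝ) + 1) + g (((M - 1 - l : ℕ) : ℝ) + 1) := by
    intro l hl
    have hl' := Finset.mem_range.1 hl
    have hl1 : ((M - 1 - l : ℕ) : ℝ) + 1 = N - ((l : ℝ) + 1) := by
      have : M - 1 - l + 1 + (l + 1) = M + 1 := by omega
      have h2 : ((M - 1 - l : ℕ) : ℝ) + 1 + ((l : ℝ) + 1) = N := by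
        rw [hNdef, ← this]
        push_cast
        ring
      linarith
    have hl0 : (0 : ℝ) ≤ ((M - 1 - l : ℕ) : ℝ) + 1 := by positivity
    have key : ∀ μ : ℝ, 0 ≤ μ → 4 * (μ / N) ≤ ‖e (((l + 1 : ℕ) : ℝ) / N) - 1‖ →
        ‖intervalKernel (M + 1) α L L' (l + 1)‖ ≤ g μ := by
      intro μ hμ hx
      have h1 := hD α L hL0 _ μ hμ hx
      have h2 := hD 0 L' hL' _ μ hμ hx
      rw [hnorm]
      calc _ ≤ 1 / N * ((3 / 2 * N / (μ + p)) * (3 / 2 * N / (μ + r))) := by gcongr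
        _ = g μ := by
          simp only [hg]
          have h3 : (L' : ℝ) * r = N := by
            rw [hr_def]
            field_simp
          have h4 : 9 / 4 * (L' : ℝ) * (r / ((μ + p) * (μ + r))) =
            9 / 4 * (L' * r) / ((μ + p) * (μ + r)) := by ring
          rw [h4, h3]
          have := hNr.ne'
          field_simp
          ring
    have hx0 : (0 : ℝ) ≤ ((l + 1 : ℕ) : ℝ) / N := by positivity
    have hx1 : ((l + 1 : ℕ) : ℝ) / N ≤ 1 := by
      rw [div_le_one hNr, hNdef]
      exact_mod_cast by omega
    have h5 := four_mul_min_le_norm_e_sub_one hx0 hx1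
    rcases min_choice (((l + 1 : ℕ) : ℝ) / N) (1 - ((l + 1 : ℕ) : ℝ) / N) with h | h
    · rw [h] at h5
      have := key ((l : ℝ) + 1) (by positivity) (by exact_mod_cast h5)
      linarith [hg0 _ hl0]
    · rw [h] at h5
      have h6 : 1 - ((l + 1 : ℕ) : ℝ) / N = (((M - 1 - l : ℕ) : ℝ) + 1) / N := by
        rw [hl1, sub_div, div_self hNr.ne']
        push_cast
        rfl
      rw [h6] at h5
      have := key _ hl0 h5
      linarith [hg0 ((l : ℝ) + 1) (by positivity)]
  have hgsum : ∑ l ∈ Finset.range M, g ((l : ℝ) + 1) ≤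
      9 / 4 * L' * (2 * Real.log (1 + (L : ℝ) / L')) := by
    have h1 := sum_div_mul_le_log hp hpr M
    have h2 : r / p = (L : ℝ) / L' := by
      rw [hp_def, hr_def]
      field_simp
    rw [h2] at h1
    simp only [hg]
    rw [← Finset.mul_sum]
    gcongr
  have hrefl := Finset.sum_range_reflect (fun l : ℕ => g ((l : ℝ) + 1)) M
  rw [Finset.sum_range_succ']
  have h1 := Finset.sum_le_sum hsucc
  rw [Finset.sum_add_distrib, hrefl] at h1
  linarith

/-! ### Selecting a residue class -/

@[fun_prop]
theorem continuous_trigPoly (d : ℕ) (c : ℤ → ℂ) : Continuous (trigPoly d c) := by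
  unfold trigPoly
  fun_prop

theorem trigPoly_periodic (d : ℕ) (c : ℤ → ℂ) : Function.Periodic (trigPoly d c) 1 := by
  intro t
  simp only [trigPoly, e_intCast_mul_add_one]

/-- Discrete de la Vallée-Poussin filter: the multiplier of the kernel of the intervals
`[-d₁, d₂ - d₁)` and `[0, d₂ - 2 d₁)` modulo `q d₂` is constant on the frequencies within `d₁` of
`q d₂ ℤ` and vanishes on those within `d₁` of the other multiples of `d₂`. -/
theorem sum_intervalKernel_mul_e_eq_ite {d₁ d₂ q : ℕ} (hd : 2 * d₁ ≤ d₂) (hd₂ : 0 < d₂)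
    (hq : 0 < q) {n : ℤ} (hn : n ∈ Finset.Icc (-(d₁ : ℤ)) d₁) (k : ℤ) :
    ∑ l ∈ Finset.range (q * d₂), intervalKernel (q * d₂) (-d₁) d₂ (d₂ - 2 * d₁) l *
        e (((d₂ * k + n : ℤ) : ℝ) * ((l : ℝ) / (q * d₂ : ℕ))) =
      if (q : ℤ) ∣ k then ((d₂ - 2 * d₁ : ℕ) : ℂ) else 0 := by
  rw [Finset.mem_Icc] at hn
  rw [sum_intervalKernel_mul_e (Nat.mul_pos hq hd₂)]
  have h1 : ∀ j ∈ Finset.range (d₂ - 2 * d₁), (∑ i ∈ Finset.range d₂,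
      if ((q * d₂ : ℕ) : ℤ) ∣ (d₂ * k + n) - (-d₁ + i) + j then (1 : ℂ) else 0) =
        if (q : ℤ) ∣ k then 1 else 0 := by
    intro j hj
    rw [Finset.mem_range] at hj
    have h2 : ∀ i ∈ Finset.range d₂,
        (((q * d₂ : ℕ) : ℤ) ∣ (d₂ * k + n) - (-d₁ + i) + j ↔
          (n + d₁ + j).toNat = i ∧ (q : ℤ) ∣ k) := by
      intro i hi
      rw [Finset.mem_range] at hi
      have h3 : (d₂ * k + n) - (-d₁ + i) + j = d₂ * k + (n + d₁ - i + j) := by ring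
      have hd₂' : (d₂ : ℤ) ≠ 0 := by exact_mod_cast hd₂.ne'
      rw [h3]
      push_cast
      constructor
      · intro h
        have h4 : (d₂ : ℤ) ∣ n + d₁ - i + j :=
          (Int.dvd_add_right (Dvd.intro _ rfl)).1 ((Dvd.intro_left _ rfl).trans h)
        have h5 : n + d₁ - i + j = 0 :=
          Int.eq_zero_of_abs_lt_dvd h4 (by rw [abs_lt]; constructor <;> omega)
        rw [h5, add_zero, mul_comm (q : ℤ)] at h
        exact ⟨by omega, Int.dvd_of_mul_dvd_mul_left hd₂' h⟩
      · rintro ⟨h4, h5⟩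
        have h6 : n + d₁ - i + j = 0 := by omega
        rw [h6, add_zero, mul_comm (q : ℤ)]
        exact mul_dvd_mul_left _ h5
    rw [Finset.sum_congr rfl fun i hi => if_congr (h2 i hi) rfl rfl]
    split_ifs with h4
    · simp only [h4, and_true]
      rw [Finset.sum_ite_eq, if_pos]
      rw [Finset.mem_range]
      omega
    · simp [h4]
  rw [Finset.sum_congr rfl h1, Finset.sum_const, Finset.card_range, nsmul_eq_mul, mul_ite,
    mul_one, mul_zero]

/-- Restricting the lacunary blocks to a residue class is bounded on `L¹`. -/
theorem normL1_residueClass_le {d₁ d₂ q : ℕ} (hd : 2 * d₁ < d₂) (hq : 0 < q)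
    (I : Finset ℤ) (a : ℤ → ℤ → ℂ) (s : ℤ) :
    normL1 (fun t => ∑ k ∈ residueClass I q s,
        trigPoly d₁ (fun n => a n k) t * e ((d₂ : ℝ) * (k : ℝ) * t)) ≤
      (1 + 9 * Real.log (1 + (d₂ : ℝ) / (d₂ - 2 * d₁ : ℕ))) *
        normL1 (fun t => ∑ k ∈ I, trigPoly d₁ (fun n => a n k) t * e ((d₂ : ℝ) * (k : ℝ) * t)) := by
  have hd₂ : 0 < d₂ := by omega
  set w := d₂ - 2 * d₁ with hw_def
  have hw : 0 < w := by omega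
  have hwr : (0 : ℝ) < w := by exact_mod_cast hw
  have hwc : (w : ℂ) ≠ 0 := by exact_mod_cast hw.ne'
  set F : ℝ → ℂ :=
    fun t => ∑ k ∈ I, trigPoly d₁ (fun n => a n k) t * e ((d₂ : ℝ) * (k : ℝ) * t) with hF
  have hFc : Continuous F := by
    simp only [hF]
    fun_prop
  have hFp : Function.Periodic F 1 := by
    intro t
    simp only [hF]
    refine Finset.sum_congr rfl fun k _ => ?_
    have h1 := e_intCast_mul_add_one (d₂ * k) t
    push_cast at h1
    rw [h1, trigPoly_periodic]
  set N := q * d₂ with hN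
  set W : ℕ → ℂ := fun l =>
    1 / w * (e (((-(d₂ * s) : ℤ) : ℝ) * ((l : ℝ) / N)) * intervalKernel N (-d₁) d₂ w l) with hW
  have hWsum : ∀ k : ℤ, ∀ n ∈ Finset.Icc (-(d₁ : ℤ)) d₁,
      ∑ l ∈ Finset.range N, W l * e (((d₂ * k + n : ℤ) : ℝ) * ((l : ℝ) / N)) =
        if k ≡ s [ZMOD q] then 1 else 0 := by
    intro k n hn
    have h1 := sum_intervalKernel_mul_e_eq_ite hd.le hd₂ hq hn (k - s)
    rw [← hN, ← hw_def] at h1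
    have h2 : ∀ l : ℕ, W l * e (((d₂ * k + n : ℤ) : ℝ) * ((l : ℝ) / N)) =
        1 / w * (intervalKernel N (-d₁) d₂ w l *
          e (((d₂ * (k - s) + n : ℤ) : ℝ) * ((l : ℝ) / N))) := by
      intro l
      have h3 : ((d₂ * (k - s) + n : ℤ) : ℝ) * ((l : ℝ) / N) =
          ((-(d₂ * s) : ℤ) : ℝ) * ((l : ℝ) / N) + ((d₂ * k + n : ℤ) : ℝ) * ((l : ℝ) / N) := by
        push_cast
        ring
      rw [h3, e_add]
      simp only [hW]
      ring
    simp_rw [h2]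
    rw [← Finset.mul_sum, h1]
    have h4 : k ≡ s [ZMOD q] ↔ (q : ℤ) ∣ k - s := by
      rw [Int.modEq_comm, Int.modEq_iff_dvd]
    simp only [h4]
    split_ifs
    · exact one_div_mul_cancel hwc
    · simp
  have hFq : ∀ t, ∑ l ∈ Finset.range N, W l * F (t + (l : ℝ) / N) =
      ∑ k ∈ residueClass I q s,
        trigPoly d₁ (fun n => a n k) t * e ((d₂ : ℝ) * (k : ℝ) * t) := by
    intro t
    rw [residueClass, Finset.sum_filter]
    simp only [hF, Finset.mul_sum]
    rw [Finset.sum_comm]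
    refine Finset.sum_congr rfl fun k _ => ?_
    have h1 : ∀ l : ℕ, W l * (trigPoly d₁ (fun n => a n k) (t + (l : ℝ) / N) *
        e ((d₂ : ℝ) * (k : ℝ) * (t + (l : ℝ) / N))) =
        ∑ n ∈ Finset.Icc (-(d₁ : ℤ)) d₁, a n k * e ((n : ℝ) * t) * e ((d₂ : ℝ) * (k : ℝ) * t) *
          (W l * e (((d₂ * k + n : ℤ) : ℝ) * ((l : ℝ) / N))) := by
      intro l
      rw [trigPoly, Finset.sum_mul, Finset.mul_sum]
      refine Finset.sum_congr rfl fun n _ => ?_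
      push_cast
      rw [mul_add, mul_add, add_mul, e_add, e_add, e_add]
      ring
    simp_rw [h1]
    rw [Finset.sum_comm]
    have h2 : ∀ n ∈ Finset.Icc (-(d₁ : ℤ)) d₁, (∑ l ∈ Finset.range N,
        a n k * e ((n : ℝ) * t) * e ((d₂ : ℝ) * (k : ℝ) * t) *
          (W l * e (((d₂ * k + n : ℤ) : ℝ) * ((l : ℝ) / N)))) =
        a n k * e ((n : ℝ) * t) * e ((d₂ : ℝ) * (k : ℝ) * t) *
          if k ≡ s [ZMOD q] then 1 else 0 := by
      intro n hn
      rw [← Finset.mul_sum, hWsum k n hn]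
    rw [Finset.sum_congr rfl h2, ← Finset.sum_mul, ← Finset.sum_mul, trigPoly]
    split_ifs <;> simp
  have hmass : ∑ l ∈ Finset.range N, ‖W l‖ ≤ 1 + 9 * Real.log (1 + (d₂ : ℝ) / w) := by
    have h1 := sum_norm_intervalKernel_le (N := N) hw (Nat.sub_le _ _)
      (Nat.le_mul_of_pos_left d₂ hq) (-d₁)
    have h2 : ∀ l, ‖W l‖ = 1 / w * ‖intervalKernel N (-d₁) d₂ w l‖ := by
      intro l
      simp only [hW]
      rw [norm_mul, norm_mul, norm_e, one_mul, norm_div, norm_one, Complex.norm_natCast]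
    simp_rw [h2]
    rw [← Finset.mul_sum, one_div_mul_eq_div, div_le_iff₀ hwr, mul_comm]
    exact h1
  rw [← funext hFq]
  refine (normL1_sum_translates_le _ W _ hFc hFp).trans ?_
  exact mul_le_mul_of_nonneg_right hmass (normL1_nonneg _)

/-! ### The Bernstein inequality in `L¹` -/

theorem intervalIntegral_swap_of_continuous {g : ℝ → ℝ → ℝ} (hg : Continuous (Function.uncurry g))
    (a b c d : ℝ) :
    ∫ x in a..b, ∫ y in c..d, g x y = ∫ y in c..d, ∫ x in a..b, g x y := by
  refine MeasureTheory.intervalIntegral_intervalIntegral_swap ?_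
  exact (hg.continuousOn.integrableOn_compact (isCompact_uIcc.prod isCompact_uIcc)).mono_set
    (Set.prod_mono Set.uIoc_subset_uIcc Set.uIoc_subset_uIcc)

theorem hasDerivAt_trigPoly (d : ℕ) (c : ℤ → ℂ) (t : ℝ) :
    HasDerivAt (trigPoly d c)
      (2 * (Real.pi : ℂ) * Complex.I * trigPoly d (fun n => n * c n) t) t := by
  unfold trigPoly
  rw [Finset.mul_sum]
  refine HasDerivAt.fun_sum fun n _ => ?_
  have h1 : HasDerivAt (fun t : ℝ => 2 * (Real.pi : ℂ) * Complex.I * ((n : ℝ) * t : ℝ))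
      (2 * (Real.pi : ℂ) * Complex.I * ((n : ℝ) * 1 : ℝ)) t :=
    (((hasDerivAt_id t).const_mul (n : ℝ)).ofReal_comp).const_mul _
  have h2 := (h1.cexp).const_mul (c n)
  refine h2.congr_deriv ?_
  simp only [e]
  push_cast
  ring

/-- The multiplier of the kernel of two equal intervals is a triangle. -/
theorem sum_intervalKernel_mul_e_triangle {d : ℕ} (hd : 0 < d) {ν : ℤ} (hν : |ν| ≤ 2 * d) :
    ∑ l ∈ Finset.range (4 * d), intervalKernel (4 * d) 0 (2 * d) (2 * d) l *
      e ((ν : ℝ) * ((l : ℝ) / (4 * d : ℕ))) = 2 * d - |ν| := by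
  rw [abs_le] at hν
  rw [sum_intervalKernel_mul_e (by omega)]
  have h1 : ∀ j ∈ Finset.range (2 * d), (∑ i ∈ Finset.range (2 * d),
      if ((4 * d : ℕ) : ℤ) ∣ ν - (0 + i) + j then (1 : ℂ) else 0) =
        if (j : ℤ) ∈ Finset.Ico (max 0 (-ν)) (min (2 * d) (2 * d - ν)) then 1 else 0 := by
    intro j hj
    rw [Finset.mem_range] at hj
    have h2 : ∀ i ∈ Finset.range (2 * d),
        (((4 * d : ℕ) : ℤ) ∣ ν - (0 + i) + j ↔ (ν + j).toNat = i ∧ 0 ≤ ν + j) := by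
      intro i hi
      rw [Finset.mem_range] at hi
      constructor
      · intro h
        have h5 : ν - (0 + i) + j = 0 :=
          Int.eq_zero_of_abs_lt_dvd h (by rw [abs_lt]; constructor <;> omega)
        omega
      · intro h
        have h5 : ν - (0 + i) + j = 0 := by omega
        rw [h5]
        exact dvd_zero _
    rw [Finset.sum_congr rfl fun i hi => if_congr (h2 i hi) rfl rfl]
    by_cases h4 : 0 ≤ ν + j
    · simp only [h4, and_true]
      rw [Finset.sum_ite_eq]
      refine if_congr ?_ rfl rfl
      rw [Finset.mem_range, Finset.mem_Ico]
      omega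
    · rw [if_neg (by rw [Finset.mem_Ico]; omega)]
      simp [h4]
  rw [Finset.sum_congr rfl h1, ← Finset.sum_filter, Finset.sum_const, nsmul_eq_mul, mul_one]
  have h3 : (Finset.filter (fun j : ℕ => (j : ℤ) ∈
      Finset.Ico (max 0 (-ν)) (min (2 * (d : ℤ)) (2 * d - ν))) (Finset.range (2 * d))).card =
      (Finset.Ico (max 0 (-ν)) (min (2 * (d : ℤ)) (2 * d - ν))).card := by
    refine Finset.card_bij (fun j _ => (j : ℤ)) ?_ ?_ ?_
    · intro j hj
      exact (Finset.mem_filter.1 hj).2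
    · intro i _ j _ h
      exact_mod_cast h
    · intro b hb
      have hb' := Finset.mem_Ico.1 hb
      refine ⟨b.toNat, ?_, by omega⟩
      rw [Finset.mem_filter, Finset.mem_range, Int.toNat_of_nonneg (by omega)]
      exact ⟨by omega, hb⟩
  rw [h3, Int.card_Ico]
  have h4 : (((min (2 * (d : ℤ)) (2 * d - ν) - max 0 (-ν)).toNat : ℤ) : ℂ) =
      ((2 * d - |ν| : ℤ) : ℂ) := by
    congr 1
    rcases abs_cases ν with h | h <;> omega
  push_cast at h4
  exact h4

/-- Bernstein's inequality in `L¹`, with the constant `2 d` in place of the optimal `d`: on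
`[-d, d]` the multiplier `n` is half the difference of two translated triangles. -/
theorem normL1_trigPoly_mul_le {d : ℕ} (hd : 0 < d) (c : ℤ → ℂ) :
    normL1 (trigPoly d fun n => n * c n) ≤ 2 * d * normL1 (trigPoly d c) := by
  set N := 4 * d with hN
  set W : ℕ → ℂ := fun l => 1 / 2 *
    ((e (((-d : ℤ) : ℝ) * ((l : ℝ) / N)) - e (((d : ℤ) : ℝ) * ((l : ℝ) / N))) *
      intervalKernel N 0 (2 * d) (2 * d) l) with hW
  have hmult : ∀ n ∈ Finset.Icc (-(d : ℤ)) d,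
      ∑ l ∈ Finset.range N, W l * e ((n : ℝ) * ((l : ℝ) / N)) = n := by
    intro n hn
    rw [Finset.mem_Icc] at hn
    have h1 := sum_intervalKernel_mul_e_triangle hd (ν := n - d) (by rw [abs_le]; omega)
    have h2 := sum_intervalKernel_mul_e_triangle hd (ν := n + d) (by rw [abs_le]; omega)
    have h3 : ∀ l : ℕ, W l * e ((n : ℝ) * ((l : ℝ) / N)) =
        1 / 2 * (intervalKernel N 0 (2 * d) (2 * d) l *
          e (((n - d : ℤ) : ℝ) * ((l : ℝ) / N)) -
          intervalKernel N 0 (2 * d) (2 * d) l * e (((n + d : ℤ) : ℝ) * ((l : ℝ) / N))) := by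
      intro l
      rw [Int.cast_sub, sub_eq_add_neg (n : ℝ), ← Int.cast_neg, Int.cast_add, add_mul, add_mul,
        e_add, e_add]
      simp only [hW]
      ring
    simp_rw [h3]
    rw [← Finset.mul_sum, Finset.sum_sub_distrib, h1, h2, abs_of_nonpos (by omega),
      abs_of_nonneg (by omega)]
    push_cast
    ring
  have hmass : ∑ l ∈ Finset.range N, ‖W l‖ ≤ 2 * d := by
    -- the kernel of two equal intervals is nonnegative, so its mass is its multiplier at `0`
    have h1 := sum_intervalKernel_mul_e_triangle hd (ν := 0) (by simp)
    have h2 : ∀ l, intervalKernel N 0 (2 * d) (2 * d) l =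
        (‖intervalKernel N 0 (2 * d) (2 * d) l‖ : ℝ) := by
      intro l
      rw [intervalKernel, Complex.conj_mul', norm_mul, norm_pow, norm_div, norm_one,
        Complex.norm_natCast, Complex.norm_real, norm_norm]
      push_cast
      rfl
    have h3 : ∑ l ∈ Finset.range N, ‖intervalKernel N 0 (2 * d) (2 * d) l‖ = 2 * d := by
      apply Complex.ofReal_injective
      rw [Complex.ofReal_sum, Finset.sum_congr rfl fun l _ => (h2 l).symm]
      simpa [hN] using h1
    rw [← h3]
    refine Finset.sum_le_sum fun l _ => ?_
    have h4 : ‖e (((-d : ℤ) : ℝ) * ((l : ℝ) / N)) - e (((d : ℤ) : ℝ) * ((l : ℝ) / N))‖ ≤ 2 := by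
      refine (norm_sub_le _ _).trans ?_
      rw [norm_e, norm_e]
      norm_num
    have h5 := mul_le_mul_of_nonneg_right h4
      (norm_nonneg (intervalKernel N 0 (2 * d) (2 * d) l))
    simp only [hW]
    rw [norm_mul, norm_mul, norm_div, norm_one, Complex.norm_ofNat]
    linarith
  have hconv : ∀ t, ∑ l ∈ Finset.range N, W l * trigPoly d c (t + (l : ℝ) / N) =
      trigPoly d (fun n => n * c n) t := by
    intro t
    simp only [trigPoly, Finset.mul_sum]
    rw [Finset.sum_comm]
    refine Finset.sum_congr rfl fun n hn => ?_
    rw [← hmult n hn, Finset.sum_mul, Finset.sum_mul]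
    refine Finset.sum_congr rfl fun l _ => ?_
    rw [mul_add, e_add]
    ring
  rw [← funext hconv]
  refine (normL1_sum_translates_le _ W _ (continuous_trigPoly d c) (trigPoly_periodic d c)).trans ?_
  exact mul_le_mul_of_nonneg_right hmass (normL1_nonneg _)

/-- Translating a trigonometric polynomial of degree `d` by `h` moves it by at most
`4 π d h` times its norm. -/
theorem normL1_trigPoly_sub_translate_le {d : ℕ} (hd : 0 < d) (c : ℤ → ℂ) {h : ℝ} (hh : 0 ≤ h) :
    normL1 (fun t => trigPoly d c t - trigPoly d c (t + h)) ≤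
      h * (4 * Real.pi * d * normL1 (trigPoly d c)) := by
  set g : ℝ → ℂ := fun t =>
    2 * (Real.pi : ℂ) * Complex.I * trigPoly d (fun n => n * c n) t with hg
  have hgc : Continuous g := by
    simp only [hg]
    fun_prop
  have hgp : Function.Periodic g 1 := fun t => by
    simp only [hg]
    rw [trigPoly_periodic]
  have h1 : ∀ t, ‖trigPoly d c t - trigPoly d c (t + h)‖ ≤ ∫ x in (0 : ℝ)..h, ‖g (t + x)‖ := by
    intro t
    have h2 : ∫ x in (0 : ℝ)..h, g (t + x) = trigPoly d c (t + h) - trigPoly d c t := by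
      rw [intervalIntegral.integral_comp_add_left g t, add_zero]
      exact intervalIntegral.integral_eq_sub_of_hasDerivAt
        (fun x _ => hasDerivAt_trigPoly d c x) (hgc.intervalIntegrable _ _)
    rw [norm_sub_rev, ← h2]
    exact intervalIntegral.norm_integral_le_integral_norm hh
  have hu : Continuous (Function.uncurry fun t x : ℝ => ‖g (t + x)‖) := by
    simp only [Function.uncurry_def]
    fun_prop
  have hnorm : normL1 g ≤ 4 * Real.pi * d * normL1 (trigPoly d c) := by
    have h3 : ‖2 * (Real.pi : ℂ) * Complex.I‖ = 2 * Real.pi := by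
      simp [abs_of_pos Real.pi_pos]
    rw [hg, normL1_const_mul, h3]
    have := mul_le_mul_of_nonneg_left (normL1_trigPoly_mul_le hd c) Real.two_pi_pos.le
    linarith
  calc _ ≤ ∫ t in (0 : ℝ)..1, ∫ x in (0 : ℝ)..h, ‖g (t + x)‖ := by
        refine intervalIntegral.integral_mono_on zero_le_one
          (Continuous.intervalIntegrable (by fun_prop) _ _) ?_ fun t _ => h1 t
        exact (intervalIntegral.continuous_parametric_intervalIntegral_of_continuous' hu
          _ _).intervalIntegrable _ _
    _ = ∫ x in (0 : ℝ)..h, normL1 g := by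
        rw [intervalIntegral_swap_of_continuous hu]
        refine intervalIntegral.integral_congr fun x _ => ?_
        exact normL1_comp_add hgp x
    _ = h * normL1 g := by simp
    _ ≤ _ := by gcongr

/-! ### A single residue class -/

/-- The inequality for a single residue class: over a window of length `1 / (q d₂)` the
coefficients `f j` are almost constant while the characters run through a full period, so that the
McGehee–Pigno–Smith inequality applies to the frozen coefficients. -/
theorem mpsConstant_mul_sum_le {d₁ d₂ q J : ℕ} (hd₁ : 0 < d₁) (hd₂ : 0 < d₂) (hq : 0 < q)
    (c : Fin J → ℤ → ℂ) (s : ℤ) {k : Fin J → ℤ} (hk : StrictMono k)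
    (hks : ∀ j, k j ≡ s [ZMOD q]) :
    mpsConstant * ∑ j, normL1 (trigPoly d₁ (c j)) / ((j : ℝ) + 1) ≤
      normL1 (fun t => ∑ j, trigPoly d₁ (c j) t * e ((d₂ : ℝ) * (k j : ℝ) * t)) +
        4 * Real.pi * d₁ / (q * d₂) * ∑ j, normL1 (trigPoly d₁ (c j)) := by
  have hqr : (0 : ℝ) < q := by exact_mod_cast hq
  have hd₂r : (0 : ℝ) < d₂ := by exact_mod_cast hd₂
  set G : ℝ → ℂ := fun t => ∑ j, trigPoly d₁ (c j) t * e ((d₂ : ℝ) * (k j : ℝ) * t) with hG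
  have hGc : Continuous G := by
    simp only [hG]
    fun_prop
  have hGp : Function.Periodic G 1 := by
    intro t
    simp only [hG]
    refine Finset.sum_congr rfl fun j _ => ?_
    have h1 := e_intCast_mul_add_one (d₂ * k j) t
    push_cast at h1
    rw [h1, trigPoly_periodic]
  -- the coefficients at time `t`, the characters at time `t + τ / (q d₂)`
  set H : ℝ → ℝ → ℂ := fun t τ =>
    ∑ j, trigPoly d₁ (c j) t * e ((d₂ : ℝ) * (k j : ℝ) * (t + τ / (q * d₂))) with hH
  have hHu : Continuous (Function.uncurry fun t τ : ℝ => ‖H t τ‖) := by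
    simp only [Function.uncurry_def, hH]
    fun_prop
  have hHu' : Continuous (Function.uncurry fun τ t : ℝ => ‖H t τ‖) := by
    simp only [Function.uncurry_def, hH]
    fun_prop
  have hlow : ∀ t, mpsConstant * ∑ j : Fin J, ‖trigPoly d₁ (c j) t‖ / ((j : ℝ) + 1) ≤
      ∫ τ in (0 : ℝ)..1, ‖H t τ‖ := by
    intro t
    choose m hm using fun j => (Int.modEq_iff_dvd.1 (hks j).symm)
    have hmm : StrictMono m := by
      intro i j hij
      have h1 := hk hij
      have h2 : (q : ℤ) * m i < q * m j := by
        rw [← hm, ← hm]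
        omega
      exact lt_of_mul_lt_mul_left h2 (by positivity)
    have h1 := isGreatest_mpsConstant.1 J m
      (fun j => trigPoly d₁ (c j) t * e ((d₂ : ℝ) * (k j : ℝ) * t)) hmm
    simp only [norm_mul, norm_e, mul_one] at h1
    refine h1.trans (le_of_eq (intervalIntegral.integral_congr fun τ _ => ?_))
    have h2 : H t τ = e ((s : ℝ) * τ / q) *
        ∑ j, trigPoly d₁ (c j) t * e ((d₂ : ℝ) * (k j : ℝ) * t) * e ((m j : ℝ) * τ) := by
      simp only [hH]
      rw [Finset.mul_sum]
      refine Finset.sum_congr rfl fun j _ => ?_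
      have h3 : (k j : ℝ) = s + q * m j := by
        have h4 : k j = s + q * m j := by linarith [hm j]
        rw [h4]
        push_cast
        rfl
      have h5 : (d₂ : ℝ) * (k j : ℝ) * (t + τ / (q * d₂)) =
          (d₂ : ℝ) * (k j : ℝ) * t + (s * τ / q + m j * τ) := by
        have h6 : (d₂ : ℝ) * (k j : ℝ) * (τ / (q * d₂)) = s * τ / q + m j * τ := by
          rw [h3]
          field_simp
        rw [mul_add, h6]
      rw [h5, e_add, e_add]
      ring
    rw [h2, norm_mul, norm_e, one_mul]
  have hup : ∀ τ ∈ Set.Icc (0 : ℝ) 1, ∫ t in (0 : ℝ)..1, ‖H t τ‖ ≤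
      normL1 G + 4 * Real.pi * d₁ / (q * d₂) * ∑ j, normL1 (trigPoly d₁ (c j)) := by
    intro τ hτ
    set h := τ / (q * d₂) with hh
    have hh0 : 0 ≤ h := div_nonneg hτ.1 (by positivity)
    have hh1 : h ≤ 1 / (q * d₂) := by
      rw [hh]
      gcongr
      exact hτ.2
    have h1 : ∀ t, ‖H t τ‖ ≤ ‖G (t + h)‖ +
        ∑ j, ‖trigPoly d₁ (c j) t - trigPoly d₁ (c j) (t + h)‖ := by
      intro t
      have h2 : H t τ = G (t + h) + ∑ j, (trigPoly d₁ (c j) t - trigPoly d₁ (c j) (t + h)) *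
          e ((d₂ : ℝ) * (k j : ℝ) * (t + h)) := by
        simp only [hH, hG]
        rw [← Finset.sum_add_distrib]
        refine Finset.sum_congr rfl fun j _ => ?_
        ring
      rw [h2]
      refine (norm_add_le _ _).trans ?_
      gcongr
      refine norm_sum_le_of_le _ fun j _ => ?_
      rw [norm_mul, norm_e, mul_one]
    calc _ ≤ ∫ t in (0 : ℝ)..1, (‖G (t + h)‖ +
            ∑ j, ‖trigPoly d₁ (c j) t - trigPoly d₁ (c j) (t + h)‖) := by
          refine intervalIntegral.integral_mono_on zero_le_one ?_
            (Continuous.intervalIntegrable (by fun_prop) _ _) fun t _ => h1 t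
          exact (hHu.comp (Continuous.prodMk continuous_id continuous_const)).intervalIntegrable _ _
      _ = normL1 G +
            ∑ j, normL1 (fun t => trigPoly d₁ (c j) t - trigPoly d₁ (c j) (t + h)) := by
          rw [intervalIntegral.integral_add (Continuous.intervalIntegrable (by fun_prop) _ _)
            (Continuous.intervalIntegrable (by fun_prop) _ _),
            intervalIntegral.integral_finsetSum
              fun j _ => Continuous.intervalIntegrable (by fun_prop) _ _]
          congr 1
          exact normL1_comp_add hGp h
      _ ≤ normL1 G + ∑ j, 1 / (q * d₂) * (4 * Real.pi * d₁ * normL1 (trigPoly d₁ (c j))) := by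
          gcongr with j _
          refine (normL1_trigPoly_sub_translate_le hd₁ (c j) hh0).trans ?_
          have := normL1_nonneg (trigPoly d₁ (c j))
          gcongr
      _ = _ := by
          rw [Finset.mul_sum]
          congr 1
          refine Finset.sum_congr rfl fun j _ => ?_
          ring
  calc _ = ∫ t in (0 : ℝ)..1,
        mpsConstant * ∑ j : Fin J, ‖trigPoly d₁ (c j) t‖ / ((j : ℝ) + 1) := by
        rw [intervalIntegral.integral_const_mul, intervalIntegral.integral_finsetSum
          fun j _ => Continuous.intervalIntegrable (by fun_prop) _ _]
        simp_rw [intervalIntegral.integral_div]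
        rfl
    _ ≤ ∫ t in (0 : ℝ)..1, ∫ τ in (0 : ℝ)..1, ‖H t τ‖ := by
        refine intervalIntegral.integral_mono_on zero_le_one
          (Continuous.intervalIntegrable (by fun_prop) _ _) ?_ fun t _ => hlow t
        exact (intervalIntegral.continuous_parametric_intervalIntegral_of_continuous' hHu
          _ _).intervalIntegrable _ _
    _ = ∫ τ in (0 : ℝ)..1, ∫ t in (0 : ℝ)..1, ‖H t τ‖ :=
        intervalIntegral_swap_of_continuous hHu _ _ _ _
    _ ≤ ∫ τ in (0 : ℝ)..1,
          (normL1 G + 4 * Real.pi * d₁ / (q * d₂) * ∑ j, normL1 (trigPoly d₁ (c j))) := by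
        refine intervalIntegral.integral_mono_on zero_le_one ?_
          (intervalIntegrable_const) hup
        exact (intervalIntegral.continuous_parametric_intervalIntegral_of_continuous' hHu'
          _ _).intervalIntegrable _ _
    _ = _ := by simp

/-- The mass of the filter in terms of the gap parameter `δ`. -/
theorem one_add_log_le {d₁ d₂ : ℕ} {δ : ℝ} (hδ : 0 < δ) (hd : 2 * d₁ < d₂)
    (h : (2 + δ) * (d₁ : ℝ) < (d₂ : ℝ)) :
    1 + 9 * Real.log (1 + (d₂ : ℝ) / (d₂ - 2 * d₁ : ℕ)) ≤
      64 * Real.pi * (2 + Real.log (1 + 2 / δ)) := by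
  have hw : ((d₂ - 2 * d₁ : ℕ) : ℝ) = d₂ - 2 * d₁ := by
    rw [Nat.cast_sub hd.le]
    push_cast
    ring
  have hw0 : (0 : ℝ) < d₂ - 2 * d₁ := by
    rw [← hw]
    exact_mod_cast Nat.sub_pos_of_lt hd
  have h1 : 1 + (d₂ : ℝ) / (d₂ - 2 * d₁) ≤ 2 * (1 + 2 / δ) := by
    have h2 : (d₂ : ℝ) / (d₂ - 2 * d₁) ≤ 1 + 2 / δ := by
      rw [div_le_iff₀ hw0]
      have h3 : 2 * (d₁ : ℝ) ≤ 2 / δ * (d₂ - 2 * d₁) := by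
        rw [div_mul_eq_mul_div, le_div_iff₀ hδ]
        linarith
      linarith
    have h4 : 0 < 2 / δ := by positivity
    linarith
  have hpos : (0 : ℝ) < 1 + (d₂ : ℝ) / (d₂ - 2 * d₁) := by positivity
  have h5 := Real.log_le_log hpos h1
  rw [Real.log_mul (by norm_num) (by positivity)] at h5
  have h6 : Real.log 2 < 1 := by linarith [Real.log_two_lt_d9]
  have h7 : 0 ≤ Real.log (1 + 2 / δ) := Real.log_nonneg (by
    have : 0 < 2 / δ := by positivity
    linarith)
  rw [hw]
  have h8 := Real.pi_gt_three
  nlinarith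

end TrigSum

theorem proposition4p1 :
    0 < TrigSum.mpsConstant ∧
    ∀ (d₁ d₂ : ℕ) (δ : ℝ), 0 < d₁ → 0 < d₂ → 0 < δ → (2 + δ) * (d₁ : ℝ) < (d₂ : ℝ) →
    ∀ (I : Finset ℤ) (a : ℤ → ℤ → ℂ) (f : ℤ → ℝ → ℂ) (F : ℝ → ℂ),
      (∀ k ∈ I, f k = TrigSum.trigPoly d₁ (fun n => a n k)) →
      (∀ t : ℝ, F t = ∑ k ∈ I, f k t * TrigSum.e ((d₂ : ℝ) * (k : ℝ) * t)) →
    ∀ (q s : ℤ), 4 * Real.pi < (q : ℝ) →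
    ∀ (J : ℕ) (k : Fin J → ℤ), StrictMono k →
      Set.range k = (TrigSum.residueClass I q s : Set ℤ) →
      1 / (32 * Real.pi * (2 + Real.log (1 + 2 / δ))) *
          ∑ j : Fin J, TrigSum.normL1 (f (k j)) *
            (TrigSum.mpsConstant / (2 * ((j : ℝ) + 1)) -
              2 * Real.pi * (d₁ : ℝ) / ((q : ℝ) * (d₂ : ℝ))) ≤
        TrigSum.normL1 F := by
  refine ⟨TrigSum.mpsConstant_pos, ?_⟩
  intro d₁ d₂ δ hd₁ hd₂ hδ hgap I a f F hf hF q s hq J k hk hrange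
  have hq0 : 0 < q := by
    have : (0 : ℝ) < q := (by positivity : (0 : ℝ) < 4 * Real.pi).trans hq
    exact_mod_cast this
  lift q to ℕ using hq0.le
  have hqn : 0 < q := by exact_mod_cast hq0
  have hd : 2 * d₁ < d₂ := by
    have h1 : (2 : ℝ) * d₁ < d₂ := by
      have : 0 ≤ δ * (d₁ : ℝ) := by positivity
      linarith
    exact_mod_cast h1
  have hmem : ∀ j, k j ∈ TrigSum.residueClass I q s := fun j => by
    rw [← Finset.mem_coe, ← hrange]
    exact Set.mem_range_self j
  have hmem' : ∀ j, k j ∈ I ∧ k j ≡ s [ZMOD q] := fun j => by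
    have := hmem j
    rwa [TrigSum.residueClass, Finset.mem_filter] at this
  have hF' : F = fun t => ∑ k ∈ I,
      TrigSum.trigPoly d₁ (fun n => a n k) t * TrigSum.e ((d₂ : ℝ) * (k : ℝ) * t) := by
    funext t
    rw [hF]
    exact Finset.sum_congr rfl fun k hk => by rw [hf k hk]
  have himage : TrigSum.residueClass I q s = Finset.univ.image k := by
    apply Finset.coe_injective
    rw [← hrange, Finset.coe_image, Finset.coe_univ, Set.image_univ]
  have hfilter := TrigSum.normL1_residueClass_le hd hqn I a s
  rw [← hF', himage] at hfilter
  simp_rw [Finset.sum_image fun i _ j _ hij => hk.injective hij] at hfilter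
  have hclass := TrigSum.mpsConstant_mul_sum_le hd₁ hd₂ hqn (fun j n => a n (k j)) s hk
    fun j => (hmem' j).2
  have hlog := TrigSum.one_add_log_le hδ hd hgap
  have hfk : ∀ j, f (k j) = TrigSum.trigPoly d₁ (fun n => a n (k j)) := fun j =>
    hf _ (hmem' j).1
  have hX : 0 < 2 + Real.log (1 + 2 / δ) := by
    have : 0 ≤ Real.log (1 + 2 / δ) := Real.log_nonneg (by
      have : 0 < 2 / δ := by positivity
      linarith)
    linarith
  have hS : 2 * ∑ j : Fin J, TrigSum.normL1 (f (k j)) *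
      (TrigSum.mpsConstant / (2 * ((j : ℝ) + 1)) -
        2 * Real.pi * (d₁ : ℝ) / ((q : ℝ) * (d₂ : ℝ))) =
      TrigSum.mpsConstant * (∑ j : Fin J,
        TrigSum.normL1 (TrigSum.trigPoly d₁ (fun n => a n (k j))) / ((j : ℝ) + 1)) -
      4 * Real.pi * d₁ / (q * d₂) *
        ∑ j : Fin J, TrigSum.normL1 (TrigSum.trigPoly d₁ (fun n => a n (k j))) := by
    rw [Finset.mul_sum, Finset.mul_sum, Finset.mul_sum, ← Finset.sum_sub_distrib]
    refine Finset.sum_congr rfl fun j _ => ?_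
    rw [hfk]
    have : (j : ℝ) + 1 ≠ 0 := by positivity
    field_simp
    ring
  have hnF := TrigSum.normL1_nonneg F
  have h1 := mul_le_mul_of_nonneg_right hlog hnF
  rw [Int.cast_natCast, one_div_mul_eq_div, div_le_iff₀ (by positivity)]
  linarith
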